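/- Let $M$ be a smooth Riemannian 4-manifold with Levi-Civita connection $\nabla$, and let $h$ be a smooth 2-form on $M$ with $dh=0$ and $d^*h=0$. (1) Let $p\in M$ and fix an orientation of $T_pM$. If $h(p)$ is neither self-dual nor anti-self-dual, then on an open neighbourhood $U$ of $p$ there is a smooth orthonormal frame $e_1,\dots,e_4$, positively oriented at $p$, with dual coframe $w^1,\dots,w^4$, and there are functions $a,b$ on $U$ with $a>|b|$, such that $h=a\,w^1\wedge w^2+b\,w^3\wedge w^4$ on $U$. (2) Let $U\subset M$ be open, and let $e_1,\dots,e_4$ be a smooth orthonormal frame on $U$, with dual coframe $w^1,\dots,w^4$, such that $h=a\,w^1\wedge w^2+b\,w^3\wedge w^4$ with $a^2>b^2$ on $U$. Write $\nabla_{e_i}e_j=\gamma_{ij}^ke_k$, $c_{ij}^k=\gamma_{ij}^k-\gamma_{ji}^k$, $R_{ijkl}=\langle R(e_i,e_j)e_k,e_l\rangle$ with $R(X,Y)=\nabla_X\nabla_Y-\nabla_Y\nabla_X-\nabla_{[X,Y]}$ (so $R_{ijji}$, $i\neq j$, is a sectional curvature), and let $\kappa=\sum_{i,j}R_{ijji}$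 be the scalar curvature. Let $\Sigma_a=\mathrm{span}(e_1,e_2)$, $\Sigma_b=\mathrm{span}(e_3,e_4)$, and put $$T_a=c_{12}^3e_3+c_{12}^4e_4,\qquad T_b=c_{34}^1e_1+c_{34}^2e_2,$$ $$II_a=\sum_{i,j\in\{1,2\}}\sum_{m\in\{3,4\}}\tfrac12(\gamma_{ij}^m+\gamma_{ji}^m)\,w^i\otimes w^j\otimes e_m,\qquad II_b=\sum_{i,j\in\{3,4\}}\sum_{m\in\{1,2\}}\tfrac12(\gamma_{ij}^m+\gamma_{ji}^m)\,w^i\otimes w^j\otimes e_m,$$ $$H_a=\sum_{m\in\{3,4\}}(\gamma_{11}^m+\gamma_{22}^m)e_m,\qquad H_b=\sum_{m\in\{1,2\}}(\gamma_{33}^m+\gamma_{44}^m)e_m.$$ Define leafwise curvatures by the Gauss equation, $$R^{\Sigma_a}_{1221}=R_{1221}+\langle II_a(e_1,e_1),II_a(e_2,e_2)\rangle-|II_a(e_1,e_2)|^2,\qquad R^{\Sigma_b}_{3443}=R_{3443}+\langle II_b(e_3,e_3),II_b(e_4,e_4)\rangle-|II_b(e_3,e_4)|^2 .$$ Let $f=\ln\sqrt{a^2-b^2}$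 on $U$ and $\Delta=d^*d$. Then $f$ is smooth on $U$, and: * on all of $U$, $\nabla f=H_a+H_b$; * at every critical point of $f$ in $U$, $$-\Delta f=R_{1331}+R_{2332}+R_{1441}+R_{2442}+|II_a|^2+|II_b|^2-\tfrac12|T_a|^2-\tfrac12|T_b|^2;$$ * on all of $U$, $$-\Delta f=\tfrac12\kappa+R_{1221}+R_{3443}-2R^{\Sigma_a}_{1221}-2R^{\Sigma_b}_{3443}-\tfrac12|T_a|^2-\tfrac12|T_b|^2;$$ * the leafwise curvatures are the intrinsic ones wherever there are leaves: if $\psi:N\to U$ is a smooth isometric immersion of a Riemannian surface tangent to $\Sigma_a$ (respectively $\Sigma_b$), then at every $q\in N$ the sectional curvature of $N$ at $q$ equals $R^{\Sigma_a}_{1221}(\psi(q))$ (respectively $R^{\Sigma_b}_{3443}(\psi(q))$). -/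

import Mathlib

open Bundle FiberBundle VectorField Module
open scoped Manifold ContDiff Topology

noncomputable section

namespace IndefBochner

section General

variable {E : Type*} [NormedAddCommGroup E] [NormedSpace ℝ E] [FiniteDimensional ℝ E]
  {H : Type*} [TopologicalSpace H] {I : ModelWithCorners ℝ E H}
  {M : Type*} [TopologicalSpace M] [ChartedSpace H M] [IsManifold I ∞ M]
  [RiemannianBundle (fun x : M ↦ TangentSpace I x)]
  [IsContMDiffRiemannianBundle I ∞ E (fun x : M ↦ TangentSpace I x)]

instance finiteDimensional_tangentSpace (x : M) : FiniteDimensional ℝ (TangentSpace I x) :=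
  inferInstanceAs (FiniteDimensional ℝ E)

instance completeSpace_tangentSpace (x : M) : CompleteSpace (TangentSpace I x) :=
  FiniteDimensional.complete ℝ _

/-! ### The Levi-Civita connection, built from the Koszul formula -/

/-- The right-hand side of the Koszul formula for `⟨∇_X Y, Z⟩`. -/
def koszul (X Y Z : Π x : M, TangentSpace I x) (x : M) : ℝ :=
  (1 / 2) * (d% (fun y ↦ inner ℝ (Y y) (Z y)) x (X x)
    + d% (fun y ↦ inner ℝ (Z y) (X y)) x (Y x)
    - d% (fun y ↦ inner ℝ (X y) (Y y)) x (Z x)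
    + inner ℝ (mlieBracket I X Y x) (Z x)
    - inner ℝ (mlieBracket I Y Z x) (X x)
    + inner ℝ (mlieBracket I Z X x) (Y x))

variable {X Y Z Y' : Π x : M, TangentSpace I x} {x : M}

set_option linter.unusedSectionVars false in
theorem mdiff_inner (hX : MDiffAt (T% X) x) (hY : MDiffAt (T% Y) x) :
    MDiffAt (fun y ↦ inner ℝ (X y) (Y y)) x :=
  MDifferentiableAt.inner_bundle (F := E) (E := fun x : M ↦ TangentSpace I x) hX hY

theorem tensorialAt_koszul_left (hY : MDiffAt (T% Y) x) (hZ : MDiffAt (T% Z) x) :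
    TensorialAt I E (fun X ↦ koszul X Y Z x) x where
  smul {f X} hf hX := by
    have hXY := mdiff_inner hX hY
    have hZX := mdiff_inner hZ hX
    have : CompleteSpace E := FiniteDimensional.complete ℝ E
    simp only [koszul, Pi.smul_apply', inner_smul_left, inner_smul_right]
    simp only [mlieBracket_smul_left hf hX, mlieBracket_smul_right hf hX]
    simp [mvfderiv_fun_mul hf hXY, mvfderiv_fun_mul hf hZX, inner_add_left, inner_smul_left]
    rw [real_inner_comm (Y x) (X x), real_inner_comm (X x) (Z x)]
    ring
  add {X X'} hX hX' := by
    have hXY := mdiff_inner hX hY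
    have hZX := mdiff_inner hZ hX
    have hXY' := mdiff_inner hX' hY
    have hZX' := mdiff_inner hZ hX'
    have : CompleteSpace E := FiniteDimensional.complete ℝ E
    simp only [koszul, Pi.add_apply, inner_add_left, inner_add_right]
    simp only [mlieBracket_add_left hX hX', mlieBracket_add_right hX hX']
    simp [mvfderiv_fun_add hXY hXY', mvfderiv_fun_add hZX hZX', inner_add_left]
    ring

theorem tensorialAt_koszul_right (hX : MDiffAt (T% X) x) (hY : MDiffAt (T% Y) x) :
    TensorialAt I E (fun Z ↦ koszul X Y Z x) x where
  smul {f Z} hf hZ := by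
    have hXY := mdiff_inner hY hZ
    have hZX := mdiff_inner hZ hX
    have : CompleteSpace E := FiniteDimensional.complete ℝ E
    simp only [koszul, Pi.smul_apply', inner_smul_left, inner_smul_right]
    simp only [mlieBracket_smul_left hf hZ, mlieBracket_smul_right hf hZ]
    simp [mvfderiv_fun_mul hf hXY, mvfderiv_fun_mul hf hZX, inner_add_left, inner_smul_left]
    rw [real_inner_comm (Y x) (Z x)]
    ring
  add {Z Z'} hX' hX'' := by
    have hXY := mdiff_inner hY hX'
    have hZX := mdiff_inner hX' hX
    have hXY' := mdiff_inner hY hX''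
    have hZX' := mdiff_inner hX'' hX
    have : CompleteSpace E := FiniteDimensional.complete ℝ E
    simp only [koszul, Pi.add_apply, inner_add_left, inner_add_right]
    simp only [mlieBracket_add_left hX' hX'', mlieBracket_add_right hX' hX'']
    simp [mvfderiv_fun_add hXY hXY', mvfderiv_fun_add hZX hZX', inner_add_left]
    ring

theorem koszul_add_mid (hX : MDiffAt (T% X) x) (hY : MDiffAt (T% Y) x) (hY' : MDiffAt (T% Y') x)
    (hZ : MDiffAt (T% Z) x) :
    koszul X (Y + Y') Z x = koszul X Y Z x + koszul X Y' Z x := by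
  have hYZ := mdiff_inner hY hZ
  have hXY := mdiff_inner hX hY
  have hYZ' := mdiff_inner hY' hZ
  have hXY' := mdiff_inner hX hY'
  have : CompleteSpace E := FiniteDimensional.complete ℝ E
  simp only [koszul, Pi.add_apply, inner_add_left, inner_add_right]
  simp only [mlieBracket_add_left hY hY', mlieBracket_add_right hY hY']
  simp [mvfderiv_fun_add hYZ hYZ', mvfderiv_fun_add hXY hXY', inner_add_left]
  ring

theorem koszul_smul_mid {f : M → ℝ} (hf : MDiffAt f x) (hX : MDiffAt (T% X) x)
    (hY : MDiffAt (T% Y) x) (hZ : MDiffAt (T% Z) x) :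
    koszul X (f • Y) Z x
      = f x * koszul X Y Z x + d% f x (X x) * inner ℝ (Y x) (Z x) := by
  have hYZ := mdiff_inner hY hZ
  have hXY := mdiff_inner hX hY
  have : CompleteSpace E := FiniteDimensional.complete ℝ E
  simp only [koszul, Pi.smul_apply', inner_smul_left, inner_smul_right]
  simp only [mlieBracket_smul_left hf hY, mlieBracket_smul_right hf hY]
  simp [mvfderiv_fun_mul hf hYZ, mvfderiv_fun_mul hf hXY, inner_add_left, inner_smul_left]
  rw [real_inner_comm (X x) (Y x)]
  ring

/-- The Koszul form `(X, Z) ↦ ⟨∇_X Y, Z⟩` at a point where `Y` is differentiable. -/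
def koszulForm (Y : Π x : M, TangentSpace I x) (x : M) (hY : MDiffAt (T% Y) x) :
    TangentSpace I x →L[ℝ] TangentSpace I x →L[ℝ] ℝ :=
  TensorialAt.mkHom₂ (I := I) (F := E) (F' := E) (fun X Z ↦ koszul X Y Z x) x
    (fun _ hZ ↦ tensorialAt_koszul_left hY hZ) (fun _ hX ↦ tensorialAt_koszul_right hX hY)

theorem koszulForm_apply (hX : MDiffAt (T% X) x) (hY : MDiffAt (T% Y) x)
    (hZ : MDiffAt (T% Z) x) : koszulForm Y x hY (X x) (Z x) = koszul X Y Z x :=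
  TensorialAt.mkHom₂_apply _ _ hX hZ

open Classical in
/-- `∇Y` at the point `x`, the linear map `v ↦ ∇_v Y`, characterized by the Koszul formula (and set
to `0` where `Y` is not differentiable). -/
def leviCivitaFun (Y : Π x : M, TangentSpace I x) (x : M) :
    TangentSpace I x →L[ℝ] TangentSpace I x :=
  if hY : MDiffAt (T% Y) x then
    LinearMap.toContinuousLinearMap
      { toFun := fun v ↦ (InnerProductSpace.toDual ℝ (TangentSpace I x)).symm (koszulForm Y x hY v)
        map_add' := by simp
        map_smul' := by simp }
  else 0

theorem inner_leviCivitaFun (hX : MDiffAt (T% X) x) (hY : MDiffAt (T% Y) x)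
    (hZ : MDiffAt (T% Z) x) :
    inner ℝ (leviCivitaFun Y x (X x)) (Z x) = koszul X Y Z x := by
  rw [← koszulForm_apply hX hY hZ]
  simp only [leviCivitaFun, dif_pos hY]
  simp

theorem inner_leviCivitaFun_extend (hY : MDiffAt (T% Y) x) (v w : TangentSpace I x) :
    inner ℝ (leviCivitaFun Y x v) w = koszul (extend E v) Y (extend E w) x := by
  have := inner_leviCivitaFun (X := extend E v) (Z := extend E w)
    (mdifferentiableAt_extend ..) hY (mdifferentiableAt_extend ..)
  simpa using this

variable (I M) in
/-- The Levi-Civita connection; `leviCivita I M Y x v` is `∇_v Y` at `x`. -/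
def leviCivita : CovariantDerivative I E (fun x : M ↦ TangentSpace I x) where
  toFun := leviCivitaFun
  isCovariantDerivativeOnUniv :=
    { add := fun {Y Y' x} hY hY' _ ↦ by
        have hs : MDiffAt (T% (Y + Y')) x := mdifferentiableAt_add_section hY hY'
        ext v
        refine ext_inner_right ℝ fun w ↦ ?_
        simp only [add_apply, inner_add_left]
        rw [inner_leviCivitaFun_extend hs, inner_leviCivitaFun_extend hY,
          inner_leviCivitaFun_extend hY', koszul_add_mid (mdifferentiableAt_extend ..) hY hY'
          (mdifferentiableAt_extend ..)]
      leibniz := fun {Y f x} hY hf _ ↦ by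
        have hs : MDiffAt (T% (f • Y)) x := hf.smul_section hY
        ext v
        refine ext_inner_right ℝ fun w ↦ ?_
        simp only [add_apply, smul_apply,
          ContinuousLinearMap.smulRight_apply, inner_add_left, inner_smul_left]
        rw [inner_leviCivitaFun_extend hs, inner_leviCivitaFun_extend hY,
          koszul_smul_mid hf (mdifferentiableAt_extend ..) hY (mdifferentiableAt_extend ..)]
        simp }

/-- The Levi-Civita connection is torsion-free. -/
theorem leviCivita_sub_swap (hX : MDiffAt (T% X) x) (hY : MDiffAt (T% Y) x) :
    leviCivita I M Y x (X x) - leviCivita I M X x (Y x) = mlieBracket I X Y x := by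
  refine ext_inner_right ℝ fun w ↦ ?_
  have h1 := inner_leviCivitaFun hX hY (mdifferentiableAt_extend I E w)
  have h2 := inner_leviCivitaFun hY hX (mdifferentiableAt_extend I E w)
  rw [extend_apply_self] at h1 h2
  change inner ℝ (leviCivitaFun Y x (X x) - leviCivitaFun X x (Y x)) w = _
  rw [inner_sub_left, h1, h2]
  simp only [koszul, extend_apply_self, real_inner_comm (X _) (Y _),
    real_inner_comm (X _) (extend E w _), real_inner_comm (Y _) (extend E w _)]
  rw [mlieBracket_swap (V := Y) (W := X), mlieBracket_swap (V := extend E w) (W := X),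
    mlieBracket_swap (V := extend E w) (W := Y)]
  simp only [Pi.neg_apply, inner_neg_left]
  ring

/-- The Levi-Civita connection is compatible with the metric. -/
theorem leviCivita_metric (hX : MDiffAt (T% X) x) (hY : MDiffAt (T% Y) x)
    (hZ : MDiffAt (T% Z) x) :
    d% (fun y ↦ inner ℝ (Y y) (Z y)) x (X x)
      = inner ℝ (leviCivita I M Y x (X x)) (Z x) + inner ℝ (Y x) (leviCivita I M Z x (X x)) := by
  change _ = inner ℝ (leviCivitaFun Y x (X x)) (Z x) + inner ℝ (Y x) (leviCivitaFun Z x (X x))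
  rw [real_inner_comm _ (Y x), inner_leviCivitaFun hX hY hZ, inner_leviCivitaFun hX hZ hY]
  simp only [koszul, real_inner_comm (X _) (Y _), real_inner_comm (Z _) (Y _),
    real_inner_comm (Z _) (X _)]
  rw [mlieBracket_swap (V := Z) (W := Y), mlieBracket_swap (V := Y) (W := X),
    mlieBracket_swap (V := Z) (W := X)]
  simp only [Pi.neg_apply, inner_neg_left]
  ring

/-! ### Gradient, divergence, Laplacian and curvature -/

/-- The gradient of a function. -/
def grad (f : M → ℝ) (x : M) : TangentSpace I x :=
  (InnerProductSpace.toDual ℝ (TangentSpace I x)).symm (d% f x)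

/-- The divergence of a vector field, the trace of `v ↦ ∇_v X`. -/
def divergence (X : Π x : M, TangentSpace I x) (x : M) : ℝ :=
  LinearMap.trace ℝ (TangentSpace I x)
    (leviCivita I M X x : TangentSpace I x →ₗ[ℝ] TangentSpace I x)

variable (I) in
/-- The nonnegative Laplacian `Δ f = d^* d f = - div ∇f`. -/
def laplacian (f : M → ℝ) (x : M) : ℝ := -divergence (I := I) (grad f) x

/-- `∇_X ∇_Y Z - ∇_Y ∇_X Z - ∇_{[X, Y]} Z` for vector fields `X`, `Y`, `Z`. -/
def curvatureField (X Y Z : Π x : M, TangentSpace I x) (x : M) : TangentSpace I x :=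
  leviCivita I M (fun y ↦ leviCivita I M Z y (Y y)) x (X x)
    - leviCivita I M (fun y ↦ leviCivita I M Z y (X y)) x (Y x)
    - leviCivita I M Z x (mlieBracket I X Y x)

/-- The Riemann curvature tensor `R(u, v, w, z) = ⟨R(u, v) w, z⟩`, computed on smooth local
extensions of the tangent vectors; for orthonormal `u`, `v` the number `R(u, v, v, u)` is the
sectional curvature of the plane they span. -/
def riem (x : M) (u v w z : TangentSpace I x) : ℝ :=
  inner ℝ (curvatureField (extend E u) (extend E v) (extend E w) x) z

variable (I) in
/-- The scalar curvature `∑ i, ∑ j, R(b i, b j, b j, b i)` for an orthonormal basis `b`. -/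
def scalarCurvature (x : M) : ℝ :=
  let b := stdOrthonormalBasis ℝ (TangentSpace I x);
  ∑ i, ∑ j, riem x (b i) (b j) (b j) (b i)

/-! ### Harmonic 2-forms -/

variable (I M) in
/-- A smooth differential 2-form. -/
structure TwoForm where
  /-- The alternating bilinear form on each tangent space. -/
  toFun (x : M) : TangentSpace I x →L[ℝ] TangentSpace I x →L[ℝ] ℝ
  alternating (x : M) (v : TangentSpace I x) : toFun x v v = 0
  contMDiff : ContMDiff I (I.prod 𝓘(ℝ, E →L[ℝ] E →L[ℝ] ℝ)) ∞
    (fun x ↦ TotalSpace.mk' (E →L[ℝ] E →L[ℝ] ℝ) x (toFun x))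

/-- The exterior derivative `dη(u, v, w)`. -/
def dForm (η : TwoForm I M) (x : M) (u v w : TangentSpace I x) : ℝ :=
  let U : Π y : M, TangentSpace I y := extend E u;
  let V : Π y : M, TangentSpace I y := extend E v;
  let W : Π y : M, TangentSpace I y := extend E w;
  d% (fun y ↦ η.toFun y (V y) (W y)) x u
    - d% (fun y ↦ η.toFun y (U y) (W y)) x v
    + d% (fun y ↦ η.toFun y (U y) (V y)) x w
    - η.toFun x (mlieBracket I U V x) w
    + η.toFun x (mlieBracket I U W x) v
    - η.toFun x (mlieBracket I V W x) u

/-- The covariant derivative `(∇_u η)(v, w)`. -/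
def covDeriv (η : TwoForm I M) (x : M) (u v w : TangentSpace I x) : ℝ :=
  let V : Π y : M, TangentSpace I y := extend E v;
  let W : Π y : M, TangentSpace I y := extend E w;
  d% (fun y ↦ η.toFun y (V y) (W y)) x u
    - η.toFun x (leviCivita I M V x u) w - η.toFun x v (leviCivita I M W x u)

/-- The codifferential `(d^* η)(w) = - ∑ i, (∇_{b i} η)(b i, w)` for an orthonormal basis `b`. -/
def codiff (η : TwoForm I M) (x : M) (w : TangentSpace I x) : ℝ :=
  let b := stdOrthonormalBasis ℝ (TangentSpace I x);
  -∑ i, covDeriv η x (b i) (b i) w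

/-- (Strongly) harmonic forms: `dη = 0` and `d^* η = 0`. -/
def TwoForm.IsHarmonic (η : TwoForm I M) : Prop :=
  (∀ x u v w, dForm η x u v w = 0) ∧ (∀ x w, codiff η x w = 0)

end General

/-! ### Self-duality on an oriented 4-dimensional Euclidean space -/

section Star

variable {V : Type*} [NormedAddCommGroup V] [InnerProductSpace ℝ V] [FiniteDimensional ℝ V]
  [Fact (finrank ℝ V = 4)]

/-- The Hodge star of a 2-form:
`(∗η)(u, v) = (1/2) ∑ k, ∑ l, η(b k, b l) vol(b k, b l, u, v)` for an orthonormal basis `b`. -/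
def hodgeStar (o : Orientation ℝ V (Fin 4)) (η : V →L[ℝ] V →L[ℝ] ℝ) (u v : V) : ℝ :=
  let b := stdOrthonormalBasis ℝ V;
  (1 / 2) * ∑ k, ∑ l, η (b k) (b l) * o.volumeForm ![b k, b l, u, v]

/-- `∗η = η`. -/
def IsSelfDual (o : Orientation ℝ V (Fin 4)) (η : V →L[ℝ] V →L[ℝ] ℝ) : Prop :=
  ∀ u v, hodgeStar o η u v = η u v

/-- `∗η = -η`. -/
def IsAntiSelfDual (o : Orientation ℝ V (Fin 4)) (η : V →L[ℝ] V →L[ℝ] ℝ) : Prop :=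
  ∀ u v, hodgeStar o η u v = -η u v

end Star

/-! ### Adapted frames on a Riemannian 4-manifold

Frames are indexed by `Fin 4`, so that `e 0, e 1, e 2, e 3` are the `e₁, e₂, e₃, e₄` of the
mathematical text; `Σ_a` is spanned by `e 0, e 1` and `Σ_b` by `e 2, e 3`. -/

section Frame

variable {M : Type*} [TopologicalSpace M] [ChartedSpace (EuclideanSpace ℝ (Fin 4)) M]
  [IsManifold (𝓡 4) ∞ M] [RiemannianBundle (fun x : M ↦ TangentSpace (𝓡 4) x)]
  [IsContMDiffRiemannianBundle (𝓡 4) ∞ (EuclideanSpace ℝ (Fin 4))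
    (fun x : M ↦ TangentSpace (𝓡 4) x)]

instance fact_finrank_tangentSpace (x : M) : Fact (finrank ℝ (TangentSpace (𝓡 4) x) = 4) :=
  ⟨finrank_euclideanSpace_fin⟩

/-- On the open set `U`, `e` is a smooth orthonormal frame with dual coframe `w`,
`h = a w¹ ∧ w² + b w³ ∧ w⁴`, and `a² > b²`. -/
structure IsAdaptedFrame (h : TwoForm (𝓡 4) M) (U : Set M)
    (e : Fin 4 → Π x : M, TangentSpace (𝓡 4) x) (a b : M → ℝ) : Prop where
  isOpen : IsOpen U
  contMDiffOn (i : Fin 4) :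
    ContMDiffOn (𝓡 4) ((𝓡 4).prod 𝓘(ℝ, EuclideanSpace ℝ (Fin 4))) ∞
      (fun x ↦ TotalSpace.mk' (EuclideanSpace ℝ (Fin 4)) x (e i x)) U
  orthonormal : ∀ x ∈ U, Orthonormal ℝ (fun i ↦ e i x)
  eq_wedge : ∀ x ∈ U, ∀ u v : TangentSpace (𝓡 4) x, h.toFun x u v =
    a x * (inner ℝ (e 0 x) u * inner ℝ (e 1 x) v - inner ℝ (e 0 x) v * inner ℝ (e 1 x) u)
    + b x * (inner ℝ (e 2 x) u * inner ℝ (e 3 x) v - inner ℝ (e 2 x) v * inner ℝ (e 3 x) u)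
  sq_lt_sq : ∀ x ∈ U, b x ^ 2 < a x ^ 2

variable (e : Fin 4 → Π x : M, TangentSpace (𝓡 4) x)

/-- `γ_{ij}^k = ⟨∇_{e_i} e_j, e_k⟩`. -/
def gam (i j k : Fin 4) (x : M) : ℝ :=
  inner ℝ (leviCivita (𝓡 4) M (e j) x (e i x)) (e k x)

/-- The torsion vector `∑_{m ∉ S} c_{ij}^m e_m`, `c_{ij}^m = γ_{ij}^m - γ_{ji}^m`, of the
distribution spanned by `e_s`, `s ∈ S`, where `S = {i, j}`. -/
def torsionVec (i j : Fin 4) (x : M) : TangentSpace (𝓡 4) x :=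
  ∑ m ∈ ({i, j} : Finset (Fin 4))ᶜ, (gam e i j m x - gam e j i m x) • e m x

/-- The value on `(e_i, e_j)` of the generalized second fundamental form of the distribution
spanned by `e_s`, `s ∈ S`: `∑_{m ∉ S} (1/2) (γ_{ij}^m + γ_{ji}^m) e_m`. -/
def secondFF (S : Finset (Fin 4)) (i j : Fin 4) (x : M) : TangentSpace (𝓡 4) x :=
  ∑ m ∈ Sᶜ, ((1 / 2) * (gam e i j m x + gam e j i m x)) • e m x

/-- The squared norm `|II|²` of the generalized second fundamental form. -/
def secondFFNormSq (S : Finset (Fin 4)) (x : M) : ℝ :=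
  ∑ i ∈ S, ∑ j ∈ S, ‖secondFF e S i j x‖ ^ 2

/-- The generalized mean curvature vector `∑_{m ∉ S} (∑_{i ∈ S} γ_{ii}^m) e_m`. -/
def meanCurv (S : Finset (Fin 4)) (x : M) : TangentSpace (𝓡 4) x :=
  ∑ m ∈ Sᶜ, (∑ i ∈ S, gam e i i m x) • e m x

/-- `R_{ijkl} = ⟨R(e_i, e_j) e_k, e_l⟩`. -/
def riemFrame (i j k l : Fin 4) (x : M) : ℝ := riem x (e i x) (e j x) (e k x) (e l x)

/-- The leafwise curvature `R^Σ_{ijji}` of the distribution `Σ` spanned by `e_i, e_j`, defined by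
the Gauss equation from the second fundamental form and the ambient curvature. -/
def leafCurv (i j : Fin 4) (x : M) : ℝ :=
  riemFrame e i j j i x
    + inner ℝ (secondFF e {i, j} i i x) (secondFF e {i, j} j j x)
    - ‖secondFF e {i, j} i j x‖ ^ 2

/-- `ψ : N → M` is a smooth isometric immersion of a Riemannian surface into `U` that is tangent to
the distribution spanned by `e_i, e_j`. -/
structure IsIntegralSurface (U : Set M) (i j : Fin 4)
    {N : Type*} [TopologicalSpace N] [ChartedSpace (EuclideanSpace ℝ (Fin 2)) N]
    [RiemannianBundle (fun q : N ↦ TangentSpace (𝓡 2) q)] (ψ : N → M) : Prop where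
  contMDiff : ContMDiff (𝓡 2) (𝓡 4) ∞ ψ
  mem (q : N) : ψ q ∈ U
  isometric (q : N) (u v : TangentSpace (𝓡 2) q) :
    inner ℝ (mfderiv (𝓡 2) (𝓡 4) ψ q u) (mfderiv (𝓡 2) (𝓡 4) ψ q v) = inner ℝ u v
  tangent (q : N) (v : TangentSpace (𝓡 2) q) :
    mfderiv (𝓡 2) (𝓡 4) ψ q v ∈ Submodule.span ℝ {e i (ψ q), e j (ψ q)}

end Frame

end IndefBochner

end

open IndefBochner

/-! Everything is computed with the connection coefficients γ_{ij}^k of an orthonormal frame,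
`christoffel` below, which are antisymmetric in j and k. Indices run from 0 to 3, as in the code.

Gradient. The equation dh(e_0, e_2, e_3) = 0 reads e_0 b = b(γ_{22}^0 + γ_{33}^0) - a c, and
d^*h(e_1) = 0 reads e_0 a = a(γ_{22}^0 + γ_{33}^0) - b c, with the same torsion coefficient c =
γ_{23}^1 - γ_{32}^1. In a e_0(a) - b e_0(b) the torsion cancels and (a² - b²) times a component of
H_b remains. The other directions are alike (`harmonic_eq`), so ∇f = H_a + H_b.

Laplacian. By Cartan's second structure equation (`riem_eq`), the derivatives of γ in the four mixed
sectional curvatures are exactly those in the divergence of H_a + H_b. What is left is an identity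
between quadratic polynomials in γ (`neg_laplacian_log_eq`): -Δf equals the mixed curvatures plus
|II_a|² + |II_b|² - |T_a|²/2 - |T_b|²/2 - |∇f|². At a critical point the last term vanishes. In
general |∇f|² = |H_a|² + |H_b|², and the Gauss equation turns |II|² - |H|² into twice the ambient
minus twice the leafwise curvature; the mixed curvatures are κ/2 - R_{0110} - R_{2332}.

Leaves. The frame pulls back to an integral surface, brackets of related fields are related, and
brackets determine γ. The tangential coefficients therefore agree, and the structure equations of
surface and ambient space differ only by terms with a normal index, which are the Gauss correction.

Existence. Let T be the skew operator of h, s = |h|² and P its Pfaffian. Then T⁴ + sT² + P² = 0, so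
T² has eigenvalues -α, -β with α + β = s and αβ = P². The discriminant s² - 4P² = (s - 2P)(s + 2P)
is positive exactly because h is neither self-dual nor anti-self-dual. Near p the larger root α is
thus smooth, and T² + β maps into its eigenspace. A unit field X there and TX/√α span an invariant
plane; completing them to an orthonormal frame gives the normal form with a = √α. -/

namespace IndefBochner

set_option linter.unusedSectionVars false

/-! ### Smooth vector fields, and Lie brackets as derivations -/

section Smooth

variable {E : Type*} [NormedAddCommGroup E] [NormedSpace ℝ E]
  {H : Type*} [TopologicalSpace H] {I : ModelWithCorners ℝ E H}
  {M : Type*} [TopologicalSpace M] [ChartedSpace H M] [IsManifold I ∞ M]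
  {E' : Type*} [NormedAddCommGroup E'] [NormedSpace ℝ E']
  {H' : Type*} [TopologicalSpace H'] {I' : ModelWithCorners ℝ E' H'}
  {M' : Type*} [TopologicalSpace M'] [ChartedSpace H' M'] [IsManifold I' ∞ M']
  {X Y Z : Π x : M, TangentSpace I x} {f g : M → ℝ} {x : M}

/-- Smoothness of a vector field at a point. -/
abbrev SmoothAt (X : Π x : M, TangentSpace I x) (x : M) : Prop :=
  ContMDiffAt I (I.prod 𝓘(ℝ, E)) ∞ (fun y ↦ TotalSpace.mk' E y (X y)) x

theorem SmoothAt.mdifferentiableAt (hX : SmoothAt X x) : MDiffAt (T% X) x :=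
  ContMDiffAt.mdifferentiableAt hX (by simp)

theorem eventually_mdifferentiableAt_of_contMDiffAt {F : Type*} [NormedAddCommGroup F]
    [NormedSpace ℝ F] {f : M → F} (hf : ContMDiffAt I 𝓘(ℝ, F) ∞ f x) :
    ∀ᶠ y in 𝓝 x, MDiffAt f y := by
  have h1 : ContMDiffAt I 𝓘(ℝ, F) 1 f x := hf.of_le (by exact_mod_cast le_top)
  filter_upwards [(contMDiffAt_iff_contMDiffAt_nhds (by simp)).1 h1] with y hy
  exact hy.mdifferentiableAt (by simp)

theorem SmoothAt.eventually_mdifferentiableAt (hX : SmoothAt X x) :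
    ∀ᶠ y in 𝓝 x, MDiffAt (T% X) y := by
  have h1 : ContMDiffAt I (I.prod 𝓘(ℝ, E)) 1 (T% X) x :=
    ContMDiffAt.of_le hX (by exact_mod_cast le_top)
  filter_upwards [(contMDiffAt_iff_contMDiffAt_nhds (by simp)).1 h1] with y hy
  exact hy.mdifferentiableAt (by simp)

theorem SmoothAt.add (hX : SmoothAt X x) (hY : SmoothAt Y x) : SmoothAt (X + Y) x :=
  ContMDiffAt.add_section hX hY

theorem SmoothAt.sub (hX : SmoothAt X x) (hY : SmoothAt Y x) : SmoothAt (X - Y) x :=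
  ContMDiffAt.sub_section hX hY

theorem SmoothAt.smul (hf : ContMDiffAt I 𝓘(ℝ) ∞ f x) (hX : SmoothAt X x) :
    SmoothAt (f • X) x :=
  ContMDiffAt.smul_section hf hX

theorem SmoothAt.sum_smul {ι : Type*} (s : Finset ι) {f : ι → M → ℝ}
    {X : ι → Π x : M, TangentSpace I x}
    (hf : ∀ i ∈ s, ContMDiffAt I 𝓘(ℝ) ∞ (f i) x) (hX : ∀ i ∈ s, SmoothAt (X i) x) :
    SmoothAt (fun y ↦ ∑ i ∈ s, f i y • X i y) x :=
  ContMDiffAt.sum_section fun i hi ↦ (hX i hi).smul (hf i hi)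

theorem SmoothAt.congr (hX : SmoothAt X x) (h : Y =ᶠ[𝓝 x] X) : SmoothAt Y x :=
  ContMDiffAt.congr_of_eventuallyEq hX (h.mono fun y hy ↦ by simp [hy])

/-- The image of a smooth vector field under the differential of a smooth map is smooth. -/
theorem SmoothAt.mfderiv_apply {φ : M → M'} (hφ : ContMDiffAt I I' ∞ φ x) (hX : SmoothAt X x) :
    ContMDiffAt I (I'.prod 𝓘(ℝ, E')) ∞
      (fun y ↦ TotalSpace.mk' E' (φ y) (mfderiv I I' φ y (X y))) x :=
  ContMDiffAt.clm_apply_of_inCoordinates (b₁ := id) (b₂ := φ) (v := X)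
    (ϕ := fun y ↦ mfderiv I I' φ y) (hφ.mfderiv_const (m := ∞) (by simp)) hX hφ

theorem SmoothAt.mvfderiv_apply (hf : ContMDiffAt I 𝓘(ℝ) ∞ f x) (hX : SmoothAt X x) :
    ContMDiffAt I 𝓘(ℝ) ∞ (fun y ↦ d% f y (X y)) x := by
  have h := SmoothAt.mfderiv_apply hf hX
  rw [contMDiffAt_totalSpace] at h
  simpa using! h.2

theorem mvfderiv_congr {F : Type*} [NormedAddCommGroup F] [NormedSpace ℝ F] {f g : M → F}
    (h : f =ᶠ[𝓝 x] g) : d% f x = d% g x := by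
  unfold mvfderiv
  rw [h.mfderiv_eq, h.self_of_nhds]

variable [CompleteSpace E]

theorem SmoothAt.mlieBracket (hX : SmoothAt X x) (hY : SmoothAt Y x) :
    SmoothAt (mlieBracket I X Y) x := by
  have : IsManifold I (minSmoothness ℝ 2) M := by simp; infer_instance
  have : IsManifold I (((⊤ : ℕ∞) : ℕ∞ω) + 1) M := by simp; infer_instance
  exact ContMDiffAt.mlieBracket_vectorField (n := ⊤) (m := ⊤) hX hY (by simp)

/-- The Lie bracket acts on functions as the commutator of derivations. -/
theorem mvfderiv_mlieBracket (hf : ContMDiffAt I 𝓘(ℝ) ∞ f x) (hX : SmoothAt X x)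
    (hY : SmoothAt Y x) :
    d% f x (VectorField.mlieBracket I X Y x)
      = d% (fun y ↦ d% f y (Y y)) x (X x) - d% (fun y ↦ d% f y (X y)) x (Y x) := by
  -- The argument reads off a scalar coefficient from a multiple of a nonzero vector; in dimension
  -- zero both sides vanish.
  by_cases hE : ∃ w : TangentSpace I x, w ≠ 0
  swap
  · push Not at hE
    rw [hE (VectorField.mlieBracket I X Y x), hE (X x), hE (Y x)]
    simp
  obtain ⟨w, hw⟩ := hE
  have : IsManifold I (minSmoothness ℝ 3) M := by simp; infer_instance
  set W : Π x : M, TangentSpace I x := extend E w with hW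
  have hWx : W x = w := by simp [hW]
  have sW : SmoothAt W x := contMDiffAt_extend I E w
  have le2 : minSmoothness ℝ 2 ≤ (∞ : ℕ∞ω) := by
    simp only [minSmoothness_of_isRCLikeNormedField]
    exact ENat.LEInfty.out
  -- The Jacobi identity for X, Y, f W minus f times the one for X, Y, W leaves ([X, Y] f - X(Y f) +
  -- Y(X f)) W = 0, since the terms with one derivative of f cancel.
  have jac := leibniz_identity_mlieBracket_apply (I := I) (U := X) (V := Y) (W := f • W)
    (ContMDiffAt.of_le hX le2) (ContMDiffAt.of_le hY le2) (ContMDiffAt.of_le (sW.smul hf) le2)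
  have jac0 := leibniz_identity_mlieBracket_apply (I := I) (U := X) (V := Y) (W := W)
    (ContMDiffAt.of_le hX le2) (ContMDiffAt.of_le hY le2) (ContMDiffAt.of_le sW le2)
  have key : ∀ Y : Π x : M, TangentSpace I x, VectorField.mlieBracket I Y (f • W) =ᶠ[𝓝 x]
      (fun y ↦ d% f y (Y y)) • W + f • VectorField.mlieBracket I Y W := by
    intro Y
    filter_upwards [eventually_mdifferentiableAt_of_contMDiffAt hf,
      sW.eventually_mdifferentiableAt] with y h1 h2
    exact mlieBracket_smul_right (V := Y) h1 h2
  have expand : ∀ X Y : Π x : M, TangentSpace I x, SmoothAt X x → SmoothAt Y x →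
      VectorField.mlieBracket I X (VectorField.mlieBracket I Y (f • W)) x
      = d% (fun y ↦ d% f y (Y y)) x (X x) • W x + d% f x (Y x) • VectorField.mlieBracket I X W x
        + (d% f x (X x) • VectorField.mlieBracket I Y W x
          + f x • VectorField.mlieBracket I X (VectorField.mlieBracket I Y W) x) := by
    intro X Y hX hY
    rw [Filter.EventuallyEq.mlieBracket_vectorField_eq (Filter.EventuallyEq.refl _ X) (key Y)]
    have s1 := SmoothAt.mvfderiv_apply hf hY
    have s2 := hY.mlieBracket sW
    rw [mlieBracket_add_right (SmoothAt.mdifferentiableAt (SmoothAt.smul s1 sW))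
      (SmoothAt.mdifferentiableAt (SmoothAt.smul hf s2)),
      mlieBracket_smul_right (s1.mdifferentiableAt (by simp)) sW.mdifferentiableAt,
      mlieBracket_smul_right (hf.mdifferentiableAt (by simp)) s2.mdifferentiableAt]
  rw [expand X Y hX hY, expand Y X hY hX,
    mlieBracket_smul_right (hf.mdifferentiableAt (by simp)) sW.mdifferentiableAt, jac0, hWx] at jac
  have h0 : (d% f x (VectorField.mlieBracket I X Y x)
      - (d% (fun y ↦ d% f y (Y y)) x (X x) - d% (fun y ↦ d% f y (X y)) x (Y x))) • w = 0 := by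
    simp only [sub_smul]
    linear_combination (norm := module) -jac
  rcases smul_eq_zero.1 h0 with h | h
  · linarith
  · exact absurd h hw

end Smooth

/-! ### Orthonormal bases and traces of bilinear forms -/

section LinearAlgebra

variable {V : Type*} [NormedAddCommGroup V] [InnerProductSpace ℝ V] [FiniteDimensional ℝ V]
  {ι ι' : Type*} [Fintype ι] [Fintype ι']

theorem Orthonormal.exists_orthonormalBasis {v : ι → V} (hv : Orthonormal ℝ v)
    (hc : Fintype.card ι = finrank ℝ V) : ∃ b : OrthonormalBasis ι ℝ V, ⇑b = v :=
  ⟨OrthonormalBasis.mk hv (hv.linearIndependent.span_eq_top_of_card_eq_finrank' hc).ge, by simp⟩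

theorem Orthonormal.sum_inner_smul {v : ι → V} (hv : Orthonormal ℝ v)
    (hc : Fintype.card ι = finrank ℝ V) (u : V) : ∑ i, inner ℝ (v i) u • v i = u := by
  obtain ⟨b, rfl⟩ := Orthonormal.exists_orthonormalBasis hv hc
  exact b.sum_repr' u

theorem Orthonormal.sum_inner_mul_inner {v : ι → V} (hv : Orthonormal ℝ v)
    (hc : Fintype.card ι = finrank ℝ V) (u w : V) :
    ∑ i, inner ℝ (v i) u * inner ℝ (v i) w = inner ℝ u w := by
  conv_rhs => rw [← Orthonormal.sum_inner_smul hv hc u]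
  simp [sum_inner, inner_smul_left]

theorem Orthonormal.ext_inner {v : ι → V} (hv : Orthonormal ℝ v)
    (hc : Fintype.card ι = finrank ℝ V) {u w : V} (h : ∀ i, inner ℝ (v i) u = inner ℝ (v i) w) :
    u = w := by
  rw [← Orthonormal.sum_inner_smul hv hc u, ← Orthonormal.sum_inner_smul hv hc w]
  simp [h]

/-- The trace of a bilinear form does not depend on the orthonormal basis. -/
theorem sum_bilin_orthonormalBasis (B : V → V → ℝ)
    (add_left : ∀ u u' v, B (u + u') v = B u v + B u' v)
    (smul_left : ∀ (c : ℝ) u v, B (c • u) v = c * B u v)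
    (add_right : ∀ u v v', B u (v + v') = B u v + B u v')
    (smul_right : ∀ (c : ℝ) u v, B u (c • v) = c * B u v)
    (b : OrthonormalBasis ι ℝ V) (b' : OrthonormalBasis ι' ℝ V) :
    ∑ i, B (b i) (b i) = ∑ i, B (b' i) (b' i) := by
  classical
  let L : V →ₗ[ℝ] V →ₗ[ℝ] ℝ := LinearMap.mk₂ ℝ B add_left smul_left add_right smul_right
  have expand (u v : V) : L u v = ∑ k, ∑ l, inner ℝ (b' k) u * inner ℝ (b' l) v * L (b' k) (b' l) := by
    conv_lhs => rw [← b'.sum_repr' u, ← b'.sum_repr' v]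
    simp only [map_sum, map_smul, LinearMap.sum_apply, LinearMap.smul_apply, smul_eq_mul,
      Finset.mul_sum]
    refine Finset.sum_comm.trans (Finset.sum_congr rfl fun k _ ↦ Finset.sum_congr rfl fun l _ ↦ ?_)
    ring
  change ∑ i, L (b i) (b i) = ∑ i, L (b' i) (b' i)
  have h1 (k l) : ∑ i, inner ℝ (b' k) (b i) * inner ℝ (b' l) (b i) = if k = l then (1 : ℝ) else 0 := by
    rw [← b'.inner_eq_ite k l, ← Orthonormal.sum_inner_mul_inner b.orthonormal
      (by rw [Module.finrank_eq_card_basis b.toBasis]) (b' k) (b' l)]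
    simp only [real_inner_comm]
  calc ∑ i, L (b i) (b i)
      = ∑ k, ∑ l, (∑ i, inner ℝ (b' k) (b i) * inner ℝ (b' l) (b i)) * L (b' k) (b' l) := by
        simp_rw [expand (b _) (b _), Finset.sum_mul]
        rw [Finset.sum_comm]
        exact Finset.sum_congr rfl fun k _ ↦ Finset.sum_comm
    _ = _ := by simp [h1]

end LinearAlgebra

/-! ### Smooth orthonormal frames and smoothness of the Levi-Civita connection -/

section General

variable {E : Type*} [NormedAddCommGroup E] [NormedSpace ℝ E] [FiniteDimensional ℝ E]
  {H : Type*} [TopologicalSpace H] {I : ModelWithCorners ℝ E H}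
  {M : Type*} [TopologicalSpace M] [ChartedSpace H M] [IsManifold I ∞ M]
  [RiemannianBundle (fun x : M ↦ TangentSpace I x)]
  [IsContMDiffRiemannianBundle I ∞ E (fun x : M ↦ TangentSpace I x)]
  {X Y Z : Π x : M, TangentSpace I x} {f g : M → ℝ} {x : M}

theorem SmoothAt.inner (hX : SmoothAt X x) (hY : SmoothAt Y x) :
    ContMDiffAt I 𝓘(ℝ) ∞ (fun y ↦ inner ℝ (X y) (Y y)) x :=
  ContMDiffAt.inner_bundle (F := E) (E := fun x : M ↦ TangentSpace I x) hX hY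

theorem SmoothAt.extend (v : TangentSpace I x) : SmoothAt (extend E v) x :=
  contMDiffAt_extend I E v

theorem eventually_smoothAt_extend (v : TangentSpace I x) :
    ∀ᶠ y in 𝓝 x, SmoothAt (FiberBundle.extend E v) y := by
  obtain ⟨s, hs, h⟩ := exists_contMDiffOn_extend I E (k := ∞) v
  filter_upwards [eventually_mem_nhds_iff.2 hs] with y hy
  exact h.contMDiffAt hy

theorem SmoothAt.inv_norm_smul (hX : SmoothAt X x) (h0 : X x ≠ 0) :
    SmoothAt (fun y ↦ (‖X y‖⁻¹ : ℝ) • X y) x := by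
  have h1 : (fun y ↦ ‖X y‖) = Real.sqrt ∘ fun y ↦ Inner.inner ℝ (X y) (X y) := by
    ext y; simp
  have h2 : ContMDiffAt I 𝓘(ℝ) ∞ (fun y ↦ ‖X y‖) x := by
    rw [h1]
    exact (Real.contDiffAt_sqrt (by simpa using h0)).contMDiffAt.comp x (hX.inner hX)
  exact SmoothAt.smul (f := fun y ↦ (‖X y‖⁻¹ : ℝ)) (h2.inv₀ (by simpa using h0)) hX

/-- Fields extending an orthonormal basis of a tangent space can be made into a smooth local
orthonormal frame by the Gram-Schmidt process. -/
theorem exists_orthonormal_frame_of_smoothAt {n : ℕ}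
    (b : OrthonormalBasis (Fin n) ℝ (TangentSpace I x)) {s : Fin n → Π y : M, TangentSpace I y}
    (hsm : ∀ i, ∀ᶠ y in 𝓝 x, SmoothAt (s i) y) (hb : ∀ i, s i x = b i) :
    ∃ e : Fin n → Π y : M, TangentSpace I y, (∀ᶠ y in 𝓝 x, ∀ i, SmoothAt (e i) y) ∧
      (∀ᶠ y in 𝓝 x, Orthonormal ℝ (fun i ↦ e i y)) ∧ (∀ i, e i x = b i) ∧
      ∀ i y, (∀ j ≤ i, ∀ k ≤ i, Inner.inner ℝ (s j y) (s k y) = if j = k then (1 : ℝ) else 0) →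
        e i y = s i y := by
  let G (i : Fin n) (y : M) : TangentSpace I y :=
    InnerProductSpace.gramSchmidt ℝ (fun j ↦ s j y) i
  have hs : (fun i ↦ s i x) = b := funext hb
  have hG (i) : G i x = b i := by
    simp only [G, hs]
    rw [InnerProductSpace.gramSchmidt_of_orthogonal]
    intro i j hij
    simp [b.inner_eq_ite, hij]
  -- At x the process returns the unit vectors b i, so by continuity no denominator vanishes nearby.
  -- This feeds the strong induction for smoothness.
  have hne {i} (hi : ∀ᶠ y in 𝓝 x, SmoothAt (G i) y) : ∀ᶠ y in 𝓝 x, G i y ≠ 0 := by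
    have h1 : ContinuousAt (fun y ↦ Inner.inner ℝ (G i y) (G i y)) x :=
      (hi.self_of_nhds.inner hi.self_of_nhds).continuousAt
    have h2 : Inner.inner ℝ (G i x) (G i x) ≠ 0 := by simp [hG]
    filter_upwards [h1.eventually_ne h2] with y hy h
    simp [h] at hy
  have smooth (i) : ∀ᶠ y in 𝓝 x, SmoothAt (G i) y := by
    induction i using WellFoundedLT.induction with
    | ind i ih =>
    have h1 : ∀ᶠ y in 𝓝 x, ∀ j ∈ Finset.Iio i, SmoothAt (G j) y ∧ G j y ≠ 0 :=
      (Finset.eventually_all _).2 fun j hj ↦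
        (ih j (Finset.mem_Iio.1 hj)).and (hne (ih j (Finset.mem_Iio.1 hj)))
    filter_upwards [h1, hsm i] with y hy hsy
    have h2 : G i = s i - fun z ↦ ∑ j ∈ Finset.Iio i,
        (Inner.inner ℝ (G j z) (s i z) / Inner.inner ℝ (G j z) (G j z)) • G j z := by
      ext z
      have := InnerProductSpace.gramSchmidt_def'' ℝ (fun j ↦ s j z) i
      simp only [Pi.sub_apply]
      refine eq_sub_of_add_eq (Eq.trans ?_ this.symm)
      simp [G]
    rw [h2]
    refine SmoothAt.sub hsy (SmoothAt.sum_smul _ (fun j hj ↦ ?_) fun j hj ↦ (hy j hj).1)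
    exact ((hy j hj).1.inner hsy).div₀ ((hy j hj).1.inner (hy j hj).1) (by simpa using (hy j hj).2)
  have all : ∀ᶠ y in 𝓝 x, ∀ i, SmoothAt (G i) y ∧ G i y ≠ 0 :=
    Filter.eventually_all.2 fun i ↦ (smooth i).and (hne (smooth i))
  refine ⟨fun i y ↦ (‖G i y‖⁻¹ : ℝ) • G i y, ?_, ?_, fun i ↦ by simp [hG], fun i y h ↦ ?_⟩
  · filter_upwards [all] with y hy i
    exact (hy i).1.inv_norm_smul (hy i).2
  · filter_upwards [all] with y hy
    refine ⟨fun i ↦ by simp [norm_smul, (hy i).2], fun i j hij ↦ ?_⟩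
    simp only [inner_smul_left, inner_smul_right]
    rw [InnerProductSpace.gramSchmidt_orthogonal ℝ _ hij]
    simp
  -- Where the initial segment is already orthonormal all projection coefficients are zero, so the
  -- process changes nothing. This lets prescribed unit fields survive as the first vectors of an
  -- adapted frame.
  · have hGs (j) (hj : j ≤ i) : G j y = s j y := by
      induction j using WellFoundedLT.induction with
      | ind j ih =>
      have h2 := InnerProductSpace.gramSchmidt_def'' ℝ (fun j ↦ s j y) j
      rw [Finset.sum_eq_zero, add_zero] at h2
      · exact h2.symm
      · intro k hk
        have hkj := Finset.mem_Iio.1 hk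
        have h3 : InnerProductSpace.gramSchmidt ℝ (fun j ↦ s j y) k = s k y :=
          ih k hkj (hkj.le.trans hj)
        rw [h3, h k (hkj.le.trans hj) j hj, if_neg hkj.ne]
        simp
    have h1 : ‖s i y‖ = 1 := by
      rw [← sq_eq_sq₀ (norm_nonneg _) zero_le_one, ← real_inner_self_eq_norm_sq,
        h i le_rfl i le_rfl, if_pos rfl, one_pow]
    change (‖G i y‖⁻¹ : ℝ) • G i y = s i y
    rw [hGs i le_rfl, h1, inv_one, one_smul]

/-- Every orthonormal basis of a tangent space extends to a smooth local orthonormal frame. -/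
theorem exists_orthonormal_frame {n : ℕ} (b : OrthonormalBasis (Fin n) ℝ (TangentSpace I x)) :
    ∃ e : Fin n → Π y : M, TangentSpace I y, (∀ᶠ y in 𝓝 x, ∀ i, SmoothAt (e i) y) ∧
      (∀ᶠ y in 𝓝 x, Orthonormal ℝ (fun i ↦ e i y)) ∧ ∀ i, e i x = b i := by
  obtain ⟨e, h1, h2, h3, -⟩ := exists_orthonormal_frame_of_smoothAt b
    (fun i ↦ eventually_smoothAt_extend (b i)) (fun i ↦ by simp)
  exact ⟨e, h1, h2, h3⟩

/-- The fields `e i` form a smooth orthonormal frame near `x`. -/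
structure IsFrameAt {ι : Type*} [Fintype ι] (e : ι → Π y : M, TangentSpace I y) (x : M) :
    Prop where
  smoothAt (i : ι) : SmoothAt (e i) x
  orthonormal : ∀ᶠ y in 𝓝 x, Orthonormal ℝ (fun i ↦ e i y)
  card : Fintype.card ι = finrank ℝ E

variable (I x) in
theorem exists_isFrameAt : ∃ e : Fin (finrank ℝ E) → Π y : M, TangentSpace I y, IsFrameAt e x := by
  obtain ⟨e, h1, h2, -⟩ := exists_orthonormal_frame (stdOrthonormalBasis ℝ (TangentSpace I x))
  exact ⟨e, h1.self_of_nhds, h2, by simp⟩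

variable {ι : Type*} [Fintype ι] {e : ι → Π y : M, TangentSpace I y}

theorem IsFrameAt.eventually_sum_smul (he : IsFrameAt e x) (X : Π y : M, TangentSpace I y) :
    X =ᶠ[𝓝 x] fun y ↦ ∑ i, Inner.inner ℝ (e i y) (X y) • e i y := by
  filter_upwards [he.orthonormal] with y hy
  exact (Orthonormal.sum_inner_smul hy he.card (X y)).symm

/-- The standard test for smoothness of a field defined pointwise by duality: its frame coefficients
suffice, because it is their combination near x. -/
theorem IsFrameAt.smoothAt_of_inner (he : IsFrameAt e x)
    (h : ∀ i, ContMDiffAt I 𝓘(ℝ) ∞ (fun y ↦ Inner.inner ℝ (e i y) (X y)) x) : SmoothAt X x :=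
  (SmoothAt.sum_smul _ (fun i _ ↦ h i) fun i _ ↦ he.smoothAt i).congr (he.eventually_sum_smul X)

theorem SmoothAt.koszul (hX : SmoothAt X x) (hY : SmoothAt Y x) (hZ : SmoothAt Z x) :
    ContMDiffAt I 𝓘(ℝ) ∞ (koszul X Y Z) x := by
  have : CompleteSpace E := FiniteDimensional.complete ℝ E
  unfold IndefBochner.koszul
  exact contMDiffAt_const.mul (((((SmoothAt.mvfderiv_apply (hY.inner hZ) hX).add
    (SmoothAt.mvfderiv_apply (hZ.inner hX) hY)).sub (SmoothAt.mvfderiv_apply (hX.inner hY) hZ)).add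
    ((hX.mlieBracket hY).inner hZ)).sub ((hY.mlieBracket hZ).inner hX) |>.add
    ((hZ.mlieBracket hX).inner hY))

theorem inner_leviCivita (hX : MDiffAt (T% X) x) (hY : MDiffAt (T% Y) x) (hZ : MDiffAt (T% Z) x) :
    Inner.inner ℝ (leviCivita I M Y x (X x)) (Z x) = koszul X Y Z x :=
  inner_leviCivitaFun hX hY hZ

/-- The coefficients in a smooth frame are Koszul expressions, which are built from smooth
operations. -/
theorem SmoothAt.leviCivita (hX : SmoothAt X x) (hY : SmoothAt Y x) :
    SmoothAt (fun y ↦ leviCivita I M Y y (X y)) x := by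
  obtain ⟨e, he⟩ := exists_isFrameAt I x
  refine he.smoothAt_of_inner fun i ↦ (hX.koszul hY (he.smoothAt i)).congr_of_eventuallyEq ?_
  filter_upwards [hX.eventually_mdifferentiableAt, hY.eventually_mdifferentiableAt,
    (he.smoothAt i).eventually_mdifferentiableAt] with y h1 h2 h3
  rw [real_inner_comm, inner_leviCivita h1 h2 h3]

theorem leviCivita_congr (hX : SmoothAt X x) (h : Y =ᶠ[𝓝 x] X) :
    IndefBochner.leviCivita I M Y x = IndefBochner.leviCivita I M X x :=
  (IndefBochner.leviCivita I M).isCovariantDerivativeOnUniv.congr_of_eventuallyEq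
    (hX.congr h).mdifferentiableAt hX.mdifferentiableAt Filter.univ_mem h

end General

/-! ### Tensoriality of the curvature -/

section General

variable {E : Type*} [NormedAddCommGroup E] [NormedSpace ℝ E] [FiniteDimensional ℝ E]
  {H : Type*} [TopologicalSpace H] {I : ModelWithCorners ℝ E H}
  {M : Type*} [TopologicalSpace M] [ChartedSpace H M] [IsManifold I ∞ M]
  [RiemannianBundle (fun x : M ↦ TangentSpace I x)]
  [IsContMDiffRiemannianBundle I ∞ E (fun x : M ↦ TangentSpace I x)]
  {X Y Z X' Y' Z' : Π x : M, TangentSpace I x} {f g : M → ℝ} {x : M}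
  {A : Type*} [AddCommGroup A] [Module ℝ A]

/-- An operation on vector fields that is linear over the smooth functions near `x`. -/
structure SmoothTensorialAt (Φ : (Π x : M, TangentSpace I x) → A) (x : M) : Prop where
  smul {f : M → ℝ} {X : Π x : M, TangentSpace I x} :
    ContMDiffAt I 𝓘(ℝ) ∞ f x → SmoothAt X x → Φ (f • X) = f x • Φ X
  add {X Y : Π x : M, TangentSpace I x} :
    SmoothAt X x → SmoothAt Y x → Φ (X + Y) = Φ X + Φ Y

namespace SmoothTensorialAt

variable {Φ : (Π x : M, TangentSpace I x) → A}

/-- Locality follows from linearity over functions. Only smoothness at x is asked of the factor, so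
the indicator of the set where the fields agree serves as cutoff: it is constantly 1 near x. -/
theorem congr (hΦ : SmoothTensorialAt Φ x) (hX : SmoothAt X x) (hY : SmoothAt Y x)
    (h : X =ᶠ[𝓝 x] Y) : Φ X = Φ Y := by
  classical
  let ψ (y : M) : ℝ := if X y = Y y then 1 else 0
  have hψx : ψ x = 1 := by simp [ψ, h.self_of_nhds]
  have hψ : ContMDiffAt I 𝓘(ℝ) ∞ ψ x :=
    (contMDiffAt_const (c := (1 : ℝ))).congr_of_eventuallyEq (h.mono fun y hy ↦ by simp [ψ, hy])
  have key : ψ • X = ψ • Y := by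
    ext1 y
    by_cases hy : X y = Y y <;> simp [ψ, hy]
  rw [← one_smul ℝ (Φ X), ← one_smul ℝ (Φ Y), ← hψx, ← hΦ.smul hψ hX, ← hΦ.smul hψ hY, key]

theorem sum_smul (hΦ : SmoothTensorialAt Φ x) {ι : Type*} (s : Finset ι) {f : ι → M → ℝ}
    {X : ι → Π x : M, TangentSpace I x}
    (hf : ∀ i, ContMDiffAt I 𝓘(ℝ) ∞ (f i) x) (hX : ∀ i, SmoothAt (X i) x) :
    Φ (fun y ↦ ∑ i ∈ s, f i y • X i y) = ∑ i ∈ s, f i x • Φ (X i) := by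
  classical
  induction s using Finset.induction_on with
  | empty =>
    have h0 : (fun y ↦ ∑ i ∈ (∅ : Finset ι), f i y • X i y) = (0 : M → ℝ) • extend E (0 : TangentSpace I x) := by
      ext1 y; simp
    rw [h0, hΦ.smul (f := 0) contMDiffAt_const (SmoothAt.extend 0)]
    simp
  | insert a s ha ih =>
    have h0 : (fun y ↦ ∑ i ∈ insert a s, f i y • X i y)
        = f a • X a + fun y ↦ ∑ i ∈ s, f i y • X i y := by
      ext1 y; simp [Finset.sum_insert ha]
    rw [h0, hΦ.add (SmoothAt.smul (hf a) (hX a)) (SmoothAt.sum_smul s (fun i _ ↦ hf i) fun i _ ↦ hX i),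
      hΦ.smul (hf a) (hX a), ih, Finset.sum_insert ha]

/-- Expanded in a local frame, the value involves the field only through its coefficients at x. It
follows that tensors defined with `extend` may be computed on any smooth extension. -/
theorem pointwise (hΦ : SmoothTensorialAt Φ x) (hX : SmoothAt X x) (hY : SmoothAt Y x)
    (h : X x = Y x) : Φ X = Φ Y := by
  obtain ⟨e, he⟩ := exists_isFrameAt I x
  have expand {X : Π x : M, TangentSpace I x} (hX : SmoothAt X x) :
      Φ X = ∑ i, (inner ℝ (e i x) (X x) : ℝ) • Φ (e i) := by
    have hs (i) : ContMDiffAt I 𝓘(ℝ) ∞ (fun y ↦ inner ℝ (e i y) (X y)) x :=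
      (he.smoothAt i).inner hX
    rw [hΦ.congr hX (SmoothAt.sum_smul _ (fun i _ ↦ hs i) fun i _ ↦ he.smoothAt i)
      (he.eventually_sum_smul X), hΦ.sum_smul _ hs he.smoothAt]
  rw [expand hX, expand hY, h]

theorem extend_eq (hΦ : SmoothTensorialAt Φ x) (hX : SmoothAt X x) :
    Φ (extend E (X x)) = Φ X :=
  hΦ.pointwise (SmoothAt.extend _) hX (by simp)

theorem extend_add (hΦ : SmoothTensorialAt Φ x) (u v : TangentSpace I x) :
    Φ (extend E (u + v)) = Φ (extend E u) + Φ (extend E v) := by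
  rw [← hΦ.add (SmoothAt.extend u) (SmoothAt.extend v)]
  exact hΦ.pointwise (SmoothAt.extend _) ((SmoothAt.extend u).add (SmoothAt.extend v)) (by simp)

theorem extend_smul (hΦ : SmoothTensorialAt Φ x) (c : ℝ) (u : TangentSpace I x) :
    Φ (extend E (c • u)) = c • Φ (extend E u) := by
  rw [← hΦ.smul (f := fun _ ↦ c) contMDiffAt_const (SmoothAt.extend u)]
  exact hΦ.pointwise (SmoothAt.extend _)
    (SmoothAt.smul (f := fun _ ↦ c) contMDiffAt_const (SmoothAt.extend u)) (by simp)

end SmoothTensorialAt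

theorem leviCivita_add (hX : SmoothAt X x) (hY : SmoothAt Y x) :
    leviCivita I M (X + Y) x = leviCivita I M X x + leviCivita I M Y x :=
  (leviCivita I M).isCovariantDerivativeOnUniv.add hX.mdifferentiableAt hY.mdifferentiableAt

theorem leviCivita_smul (hf : ContMDiffAt I 𝓘(ℝ) ∞ f x) (hX : SmoothAt X x) :
    leviCivita I M (f • X) x = f x • leviCivita I M X x + (d% f x).smulRight (X x) :=
  (leviCivita I M).isCovariantDerivativeOnUniv.leibniz hX.mdifferentiableAt
    (hf.mdifferentiableAt (by simp))

theorem curvatureField_swap : curvatureField X Y Z x = -curvatureField Y X Z x := by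
  simp only [curvatureField]
  rw [mlieBracket_swap_apply, map_neg]
  abel

/-- The derivative of f along Y produced by the Leibniz rule is cancelled by the one from [f X, Y].
-/
theorem smoothTensorialAt_curvatureField_left (_hY : SmoothAt Y x) (hZ : SmoothAt Z x) :
    SmoothTensorialAt (fun X ↦ curvatureField X Y Z x) x where
  smul {f X} hf hX := by
    have : CompleteSpace E := FiniteDimensional.complete ℝ E
    have h1 : (fun y ↦ leviCivita I M Z y ((f • X) y)) = f • fun y ↦ leviCivita I M Z y (X y) := by
      ext1 y; simp
    simp only [curvatureField]
    rw [h1, leviCivita_smul hf (hX.leviCivita hZ),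
      mlieBracket_smul_left (hf.mdifferentiableAt (by simp)) hX.mdifferentiableAt]
    simp only [add_apply, smul_apply, ContinuousLinearMap.smulRight_apply, Pi.smul_apply', map_add,
      map_smul, neg_smul, map_neg]
    module
  add {X X'} hX hX' := by
    have : CompleteSpace E := FiniteDimensional.complete ℝ E
    have h1 : (fun y ↦ leviCivita I M Z y ((X + X') y))
        = (fun y ↦ leviCivita I M Z y (X y)) + fun y ↦ leviCivita I M Z y (X' y) := by
      ext1 y; simp
    simp only [curvatureField]
    rw [h1, leviCivita_add (hX.leviCivita hZ) (hX'.leviCivita hZ),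
      mlieBracket_add_left hX.mdifferentiableAt hX'.mdifferentiableAt]
    simp only [add_apply, Pi.add_apply, map_add]
    module

theorem smoothTensorialAt_curvatureField_mid (hX : SmoothAt X x) (hZ : SmoothAt Z x) :
    SmoothTensorialAt (fun Y ↦ curvatureField X Y Z x) x where
  smul {f Y} hf hY := by
    have := (smoothTensorialAt_curvatureField_left hX hZ).smul hf hY
    simp only [curvatureField_swap (X := X)]
    simp only [this, smul_neg]
  add {Y Y'} hY hY' := by
    have := (smoothTensorialAt_curvatureField_left hX hZ).add hY hY'
    simp only [curvatureField_swap (X := X)]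
    simp only [this, neg_add]

/-- Replacing Z by f Z, the cross terms with one derivative of f cancel by antisymmetry, and the
coefficient of Z itself is X(Y f) - Y(X f) - [X, Y] f, which vanishes by `mvfderiv_mlieBracket`. -/
theorem smoothTensorialAt_curvatureField_right (hX : SmoothAt X x) (hY : SmoothAt Y x) :
    SmoothTensorialAt (fun Z ↦ curvatureField X Y Z x) x where
  smul {f Z} hf hZ := by
    have : CompleteSpace E := FiniteDimensional.complete ℝ E
    have key (W V : Π y : M, TangentSpace I y) (hW : SmoothAt W x) :
        leviCivita I M (fun y ↦ leviCivita I M (f • Z) y (W y)) x (V x)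
          = f x • leviCivita I M (fun y ↦ leviCivita I M Z y (W y)) x (V x)
            + d% f x (V x) • leviCivita I M Z x (W x)
            + (d% f x (W x) • leviCivita I M Z x (V x)
              + d% (fun y ↦ d% f y (W y)) x (V x) • Z x) := by
      have h1 : (fun y ↦ leviCivita I M (f • Z) y (W y)) =ᶠ[𝓝 x]
          f • (fun y ↦ leviCivita I M Z y (W y)) + (fun y ↦ d% f y (W y)) • Z := by
        filter_upwards [eventually_mdifferentiableAt_of_contMDiffAt hf,
          hZ.eventually_mdifferentiableAt] with y h1 h2
        have := (leviCivita I M).isCovariantDerivativeOnUniv.leibniz h2 h1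
        rw [this]
        rfl
      have s1 := SmoothAt.smul hf (hW.leviCivita hZ)
      have s2 := SmoothAt.smul (SmoothAt.mvfderiv_apply hf hW) hZ
      rw [leviCivita_congr (s1.add s2) h1, leviCivita_add s1 s2,
        leviCivita_smul hf (hW.leviCivita hZ), leviCivita_smul (SmoothAt.mvfderiv_apply hf hW) hZ]
      simp
    simp only [curvatureField]
    rw [key Y X hY, key X Y hX, leviCivita_smul hf hZ]
    simp only [add_apply, smul_apply, ContinuousLinearMap.smulRight_apply]
    rw [mvfderiv_mlieBracket hf hX hY]
    module
  add {Z Z'} hZ hZ' := by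
    have key (W V : Π y : M, TangentSpace I y) (hW : SmoothAt W x) :
        leviCivita I M (fun y ↦ leviCivita I M (Z + Z') y (W y)) x (V x)
          = leviCivita I M (fun y ↦ leviCivita I M Z y (W y)) x (V x)
            + leviCivita I M (fun y ↦ leviCivita I M Z' y (W y)) x (V x) := by
      have h1 : (fun y ↦ leviCivita I M (Z + Z') y (W y)) =ᶠ[𝓝 x]
          (fun y ↦ leviCivita I M Z y (W y)) + (fun y ↦ leviCivita I M Z' y (W y)) := by
        filter_upwards [hZ'.eventually_mdifferentiableAt,
          hZ.eventually_mdifferentiableAt] with y h1 h2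
        have := (leviCivita I M).isCovariantDerivativeOnUniv.add h2 h1
        rw [this]
        rfl
      have s1 := hW.leviCivita hZ
      have s2 := hW.leviCivita hZ'
      rw [leviCivita_congr (s1.add s2) h1, leviCivita_add s1 s2]
      simp
    simp only [curvatureField]
    rw [key Y X hY, key X Y hX, leviCivita_add hZ hZ']
    simp only [add_apply]
    module

/-- The curvature tensor can be computed on any smooth extensions of the tangent vectors. -/
theorem riem_apply (hX : SmoothAt X x) (hY : SmoothAt Y x) (hZ : SmoothAt Z x)
    (z : TangentSpace I x) :
    riem x (X x) (Y x) (Z x) z = inner ℝ (curvatureField X Y Z x) z := by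
  unfold riem
  have s := SmoothAt.extend (I := I) (x := x)
  rw [(smoothTensorialAt_curvatureField_left (s (Y x)) (s (Z x))).extend_eq hX,
    (smoothTensorialAt_curvatureField_mid hX (s (Z x))).extend_eq hY,
    (smoothTensorialAt_curvatureField_right hX hY).extend_eq hZ]

section Linear

variable (u u' v v' w w' z z' : TangentSpace I x) (c : ℝ)

theorem riem_add_left : riem x (u + u') v w z = riem x u v w z + riem x u' v w z := by
  unfold riem
  rw [(smoothTensorialAt_curvatureField_left (SmoothAt.extend v) (SmoothAt.extend w)).extend_add,
    inner_add_left]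

theorem riem_smul_left : riem x (c • u) v w z = c * riem x u v w z := by
  unfold riem
  rw [(smoothTensorialAt_curvatureField_left (SmoothAt.extend v) (SmoothAt.extend w)).extend_smul,
    real_inner_smul_left]

theorem riem_add_mid : riem x u (v + v') w z = riem x u v w z + riem x u v' w z := by
  unfold riem
  rw [(smoothTensorialAt_curvatureField_mid (SmoothAt.extend u) (SmoothAt.extend w)).extend_add,
    inner_add_left]

theorem riem_smul_mid : riem x u (c • v) w z = c * riem x u v w z := by
  unfold riem
  rw [(smoothTensorialAt_curvatureField_mid (SmoothAt.extend u) (SmoothAt.extend w)).extend_smul,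
    real_inner_smul_left]

theorem riem_add_right : riem x u v (w + w') z = riem x u v w z + riem x u v w' z := by
  unfold riem
  rw [(smoothTensorialAt_curvatureField_right (SmoothAt.extend u) (SmoothAt.extend v)).extend_add,
    inner_add_left]

theorem riem_smul_right : riem x u v (c • w) z = c * riem x u v w z := by
  unfold riem
  rw [(smoothTensorialAt_curvatureField_right (SmoothAt.extend u) (SmoothAt.extend v)).extend_smul,
    real_inner_smul_left]

theorem riem_add_last : riem x u v w (z + z') = riem x u v w z + riem x u v w z' :=
  inner_add_right ..

theorem riem_smul_last : riem x u v w (c • z) = c * riem x u v w z :=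
  real_inner_smul_right ..

/-- The double sum is a trace over the two middle slots followed by a trace over the two outer ones,
and each is independent of the basis. -/
theorem scalarCurvature_eq {ι : Type*} [Fintype ι] (b : OrthonormalBasis ι ℝ (TangentSpace I x)) :
    scalarCurvature I x = ∑ i, ∑ j, riem x (b i) (b j) (b j) (b i) := by
  have h1 (u u' : TangentSpace I x) :
      ∑ i, riem x u (stdOrthonormalBasis ℝ (TangentSpace I x) i)
        (stdOrthonormalBasis ℝ (TangentSpace I x) i) u' = ∑ j, riem x u (b j) (b j) u' :=
    sum_bilin_orthonormalBasis (fun v w ↦ riem x u v w u') (fun _ _ _ ↦ riem_add_mid ..)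
      (fun _ _ _ ↦ riem_smul_mid ..) (fun _ _ _ ↦ riem_add_right ..)
      (fun _ _ _ ↦ riem_smul_right ..) _ _
  simp only [scalarCurvature, h1]
  exact sum_bilin_orthonormalBasis (fun u u' ↦ ∑ j, riem x u (b j) (b j) u')
    (fun _ _ _ ↦ by simp only [riem_add_left, Finset.sum_add_distrib])
    (fun _ _ _ ↦ by simp only [riem_smul_left, Finset.mul_sum])
    (fun _ _ _ ↦ by simp only [riem_add_last, Finset.sum_add_distrib])
    (fun _ _ _ ↦ by simp only [riem_smul_last, Finset.mul_sum]) _ _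

end Linear

end General

/-! ### Structure equations, divergence, d and d^* in an orthonormal frame -/

section General

variable {E : Type*} [NormedAddCommGroup E] [NormedSpace ℝ E] [FiniteDimensional ℝ E]
  {H : Type*} [TopologicalSpace H] {I : ModelWithCorners ℝ E H}
  {M : Type*} [TopologicalSpace M] [ChartedSpace H M] [IsManifold I ∞ M]
  [RiemannianBundle (fun x : M ↦ TangentSpace I x)]
  [IsContMDiffRiemannianBundle I ∞ E (fun x : M ↦ TangentSpace I x)]
  {X Y Z V W : Π x : M, TangentSpace I x} {f g : M → ℝ} {x : M}
  {ι : Type*} [Fintype ι] {e : ι → Π y : M, TangentSpace I y}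

/-- The connection coefficients `⟨∇_{e_i} e_j, e_k⟩` of a frame. -/
noncomputable def christoffel (e : ι → Π y : M, TangentSpace I y) (i j k : ι) (y : M) : ℝ :=
  inner ℝ (leviCivita I M (e j) y (e i y)) (e k y)

theorem SmoothAt.metric (hX : SmoothAt X x) (hY : SmoothAt Y x) (hZ : SmoothAt Z x) :
    d% (fun y ↦ Inner.inner ℝ (Y y) (Z y)) x (X x)
      = Inner.inner ℝ (IndefBochner.leviCivita I M Y x (X x)) (Z x)
        + Inner.inner ℝ (Y x) (IndefBochner.leviCivita I M Z x (X x)) :=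
  leviCivita_metric hX.mdifferentiableAt hY.mdifferentiableAt hZ.mdifferentiableAt

namespace IsFrameAt

theorem smoothAt_christoffel (he : IsFrameAt e x) (i j k : ι) :
    ContMDiffAt I 𝓘(ℝ) ∞ (christoffel e i j k) x :=
  ((he.smoothAt i).leviCivita (he.smoothAt j)).inner (he.smoothAt k)

theorem mvfderiv_inner (he : IsFrameAt e x) (i j : ι) :
    d% (fun y ↦ inner ℝ (e i y) (e j y)) x = 0 := by
  classical
  have h : (fun y ↦ inner ℝ (e i y) (e j y)) =ᶠ[𝓝 x] fun _ ↦ if i = j then (1 : ℝ) else 0 := by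
    filter_upwards [he.orthonormal] with y hy
    exact orthonormal_iff_ite.1 hy i j
  rw [mvfderiv_congr h, mvfderiv_const]

/-- Metric compatibility applied to the constant function ⟨e_j, e_k⟩. -/
theorem christoffel_antisymm (he : IsFrameAt e x) (i j k : ι) :
    christoffel e i j k x = -christoffel e i k j x := by
  have h := SmoothAt.metric (he.smoothAt i) (he.smoothAt j) (he.smoothAt k)
  rw [he.mvfderiv_inner, real_inner_comm _ (e j x)] at h
  simp only [christoffel]
  have h0 : (0 : TangentSpace I x →L[ℝ] ℝ) (e i x) = 0 := rfl
  linarith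

theorem christoffel_self (he : IsFrameAt e x) (i j : ι) : christoffel e i j j x = 0 := by
  linarith [he.christoffel_antisymm i j j]

theorem leviCivita_eq_sum (he : IsFrameAt e x) (i j : ι) :
    leviCivita I M (e j) x (e i x) = ∑ k, christoffel e i j k x • e k x := by
  conv_lhs => rw [← Orthonormal.sum_inner_smul he.orthonormal.self_of_nhds he.card
    (leviCivita I M (e j) x (e i x))]
  simp only [christoffel, real_inner_comm]

theorem inner_leviCivita_leviCivita (he : IsFrameAt e x) (i j k l : ι) :
    inner ℝ (leviCivita I M (e j) x (e i x)) (leviCivita I M (e l) x (e k x))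
      = ∑ m, christoffel e i j m x * christoffel e k l m x := by
  rw [he.leviCivita_eq_sum i j, sum_inner]
  refine Finset.sum_congr rfl fun m _ ↦ ?_
  rw [real_inner_smul_left, real_inner_comm]
  rfl

theorem mlieBracket_eq (he : IsFrameAt e x) (i j : ι) :
    mlieBracket I (e i) (e j) x
      = ∑ m, (christoffel e i j m x - christoffel e j i m x) • e m x := by
  rw [← leviCivita_sub_swap (he.smoothAt i).mdifferentiableAt (he.smoothAt j).mdifferentiableAt,
    he.leviCivita_eq_sum, he.leviCivita_eq_sum, ← Finset.sum_sub_distrib]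
  simp only [sub_smul]

theorem inner_mlieBracket (he : IsFrameAt e x) (i j k : ι) :
    inner ℝ (mlieBracket I (e i) (e j) x) (e k x)
      = christoffel e i j k x - christoffel e j i k x := by
  rw [← leviCivita_sub_swap (he.smoothAt i).mdifferentiableAt (he.smoothAt j).mdifferentiableAt,
    inner_sub_left]
  rfl

/-- The Koszul formula with its derivative terms gone. The coefficients thus depend only on brackets
and inner products, both of which are preserved by isometric immersions relating the frames. -/
theorem christoffel_eq_mlieBracket (he : IsFrameAt e x) (i j k : ι) :
    christoffel e i j k x = 1 / 2 * (inner ℝ (mlieBracket I (e i) (e j) x) (e k x)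
      - inner ℝ (mlieBracket I (e j) (e k) x) (e i x)
      + inner ℝ (mlieBracket I (e k) (e i) x) (e j x)) := by
  simp only [he.inner_mlieBracket]
  linarith [he.christoffel_antisymm i j k, he.christoffel_antisymm j k i,
    he.christoffel_antisymm k i j]

/-- The curvature in an orthonormal frame (Cartan's second structure equation). -/
theorem riem_eq (he : IsFrameAt e x) (i j k l : ι) :
    riem x (e i x) (e j x) (e k x) (e l x)
      = d% (christoffel e j k l) x (e i x) - d% (christoffel e i k l) x (e j x)
        + ∑ m, (christoffel e j k m x * christoffel e i m l x
          - christoffel e i k m x * christoffel e j m l x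
          - (christoffel e i j m x - christoffel e j i m x) * christoffel e m k l x) := by
  rw [riem_apply (he.smoothAt i) (he.smoothAt j) (he.smoothAt k)]
  have key (i j : ι) : inner ℝ (leviCivita I M (fun y ↦ leviCivita I M (e k) y (e j y)) x (e i x))
      (e l x) = d% (christoffel e j k l) x (e i x)
        + ∑ m, christoffel e j k m x * christoffel e i m l x := by
    -- Differentiating ⟨∇_{e_j} e_k, e_l⟩ along e_i gives the wanted term plus ⟨∇_{e_j} e_k, ∇_{e_i}
    -- e_l⟩; antisymmetry of γ turns the latter into the quadratic sum.
    have h := SmoothAt.metric (he.smoothAt i) ((he.smoothAt j).leviCivita (he.smoothAt k))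
      (he.smoothAt l)
    rw [he.inner_leviCivita_leviCivita] at h
    simp only [he.christoffel_antisymm i l, mul_neg, Finset.sum_neg_distrib] at h
    rw [← sub_eq_iff_eq_add, sub_eq_add_neg]
    exact h.symm
  simp only [curvatureField, inner_sub_left]
  rw [key, key, he.mlieBracket_eq, map_sum, sum_inner]
  simp only [map_smul, real_inner_smul_left, Finset.sum_sub_distrib]
  simp only [christoffel]
  ring

/-- The divergence in an orthonormal frame. -/
theorem divergence_eq (he : IsFrameAt e x) (hX : SmoothAt X x) :
    divergence X x = ∑ i, (d% (fun y ↦ inner ℝ (X y) (e i y)) x (e i x)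
      - ∑ m, inner ℝ (X x) (e m x) * christoffel e i i m x) := by
  obtain ⟨b, hb⟩ := Orthonormal.exists_orthonormalBasis he.orthonormal.self_of_nhds he.card
  unfold divergence
  rw [LinearMap.trace_eq_sum_inner _ b, hb]
  refine Finset.sum_congr rfl fun i _ ↦ ?_
  rw [SmoothAt.metric (he.smoothAt i) hX (he.smoothAt i), he.leviCivita_eq_sum, inner_sum]
  simp only [real_inner_smul_right]
  rw [real_inner_comm]
  simp only [ContinuousLinearMap.coe_coe, mul_comm]
  ring

end IsFrameAt

section TwoForm

variable (η : TwoForm I M)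

theorem TwoForm.antisymm (u v : TangentSpace I x) : η.toFun x u v = -η.toFun x v u := by
  have h := η.alternating x (u + v)
  simp only [map_add, add_apply, η.alternating, zero_add, add_zero] at h
  linarith

theorem TwoForm.smoothAt (hX : SmoothAt X x) (hY : SmoothAt Y x) :
    ContMDiffAt I 𝓘(ℝ) ∞ (fun y ↦ η.toFun y (X y) (Y y)) x := by
  have : ContMDiffAt I (I.prod 𝓘(ℝ)) ∞
      (fun m ↦ TotalSpace.mk' ℝ (E := Bundle.Trivial M ℝ) m (η.toFun m (X m) (Y m))) x :=
    ContMDiffAt.clm_bundle_apply₂ (F₁ := E) (F₂ := E) (η.contMDiff x) hX hY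
  simp only [contMDiffAt_totalSpace] at this
  exact this.2

theorem smoothTensorialAt_covDeriv (u : TangentSpace I x) (hW : SmoothAt W x) :
    SmoothTensorialAt (fun V ↦ d% (fun y ↦ η.toFun y (V y) (W y)) x u
      - η.toFun x (leviCivita I M V x u) (W x) - η.toFun x (V x) (leviCivita I M W x u)) x where
  smul {f V} hf hV := by
    have h1 := mvfderiv_fun_mul (hf.mdifferentiableAt (by simp))
      ((η.smoothAt hV hW).mdifferentiableAt (by simp))
    simp only [Pi.smul_apply', map_smul, smul_apply, smul_eq_mul]
    rw [h1, leviCivita_smul hf hV]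
    simp only [add_apply, smul_apply, ContinuousLinearMap.smulRight_apply, map_add, map_smul,
      smul_eq_mul]
    ring
  add {V V'} hV hV' := by
    have h1 := mvfderiv_fun_add ((η.smoothAt hV hW).mdifferentiableAt (by simp))
      ((η.smoothAt hV' hW).mdifferentiableAt (by simp))
    simp only [Pi.add_apply, map_add, add_apply]
    rw [h1, leviCivita_add hV hV']
    simp only [add_apply, map_add]
    ring

theorem covDeriv_swap (u v w : TangentSpace I x) : covDeriv η x u v w = -covDeriv η x u w v := by
  simp only [covDeriv]
  have h : (fun y ↦ η.toFun y (extend E v y) (extend E w y))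
      = fun y ↦ -η.toFun y (extend E w y) (extend E v y) := by
    ext1 y; exact η.antisymm _ _
  rw [h, mvfderiv_fun_neg, η.antisymm v, η.antisymm _ w]
  simp only [neg_apply]
  ring

/-- Tensoriality is known in the first slot; antisymmetry of the form, in `h1`, transports it to the
second, so both extensions can be exchanged for V and W. -/
theorem covDeriv_apply (u : TangentSpace I x) (hV : SmoothAt V x) (hW : SmoothAt W x) :
    covDeriv η x u (V x) (W x) = d% (fun y ↦ η.toFun y (V y) (W y)) x u
      - η.toFun x (leviCivita I M V x u) (W x) - η.toFun x (V x) (leviCivita I M W x u) := by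
  have h1 (V W : Π y : M, TangentSpace I y) :
      d% (fun y ↦ η.toFun y (V y) (W y)) x u
      - η.toFun x (leviCivita I M V x u) (W x) - η.toFun x (V x) (leviCivita I M W x u)
      = -(d% (fun y ↦ η.toFun y (W y) (V y)) x u
      - η.toFun x (leviCivita I M W x u) (V x) - η.toFun x (W x) (leviCivita I M V x u)) := by
    have h : (fun y ↦ η.toFun y (V y) (W y)) = fun y ↦ -η.toFun y (W y) (V y) := by
      ext1 y; exact η.antisymm _ _
    rw [h, mvfderiv_fun_neg, η.antisymm _ (W x), η.antisymm (V x)]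
    simp only [neg_apply]
    ring
  have s (v : TangentSpace I x) := SmoothAt.extend v
  have h2 := (smoothTensorialAt_covDeriv η u (s (W x))).extend_eq hV
  have h3 := (smoothTensorialAt_covDeriv η u hV).extend_eq hW
  simp only [extend_apply_self] at h2 h3
  simp only [covDeriv]
  have h4 := h1 V (extend E (W x))
  simp only [extend_apply_self] at h4
  rw [h2, h1 V W, ← h3, h4]

theorem covDeriv_add_mid (u v v' w : TangentSpace I x) :
    covDeriv η x u (v + v') w = covDeriv η x u v w + covDeriv η x u v' w := by
  have := (smoothTensorialAt_covDeriv η u (SmoothAt.extend w)).extend_add v v'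
  simpa only [covDeriv, extend_apply_self, smul_eq_mul] using this

theorem covDeriv_smul_mid (c : ℝ) (u v w : TangentSpace I x) :
    covDeriv η x u (c • v) w = c * covDeriv η x u v w := by
  have := (smoothTensorialAt_covDeriv η u (SmoothAt.extend w)).extend_smul c v
  simpa only [covDeriv, extend_apply_self, smul_eq_mul] using this

theorem codiff_eq (b : OrthonormalBasis ι ℝ (TangentSpace I x)) (w : TangentSpace I x) :
    codiff η x w = -∑ i, covDeriv η x (b i) (b i) w := by
  simp only [codiff]
  rw [sum_bilin_orthonormalBasis (fun u v ↦ covDeriv η x u v w) _ _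
    (fun _ _ _ ↦ covDeriv_add_mid ..) (fun _ _ _ ↦ covDeriv_smul_mid ..) _ b]
  · intro u u' v
    simp only [covDeriv, map_add, add_apply]
    ring
  · intro c u v
    simp only [covDeriv, map_smul, smul_apply, smul_eq_mul]
    ring

/-- Since the connection has no torsion, brackets become differences of covariant derivatives and dη
is the cyclic sum of ∇η. -/
theorem dForm_eq (u v w : TangentSpace I x) : dForm η x u v w
    = covDeriv η x u v w + covDeriv η x v w u + covDeriv η x w u v := by
  have s (v : TangentSpace I x) := (SmoothAt.extend v).mdifferentiableAt
  rw [covDeriv_swap η v]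
  simp only [dForm, covDeriv]
  rw [← leviCivita_sub_swap (s u) (s v), ← leviCivita_sub_swap (s u) (s w),
    ← leviCivita_sub_swap (s v) (s w)]
  simp only [extend_apply_self, map_sub, sub_apply]
  linarith [η.antisymm u (leviCivita I M (extend E w) x v),
    η.antisymm u (leviCivita I M (extend E v) x w), η.antisymm v (leviCivita I M (extend E w) x u),
    η.antisymm w (leviCivita I M (extend E v) x u), η.antisymm w (leviCivita I M (extend E u) x v),
    η.antisymm v (leviCivita I M (extend E u) x w)]

theorem IsFrameAt.covDeriv_eq (he : IsFrameAt e x) (i j k : ι) :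
    covDeriv η x (e i x) (e j x) (e k x)
      = d% (fun y ↦ η.toFun y (e j y) (e k y)) x (e i x)
        - ∑ l, christoffel e i j l x * η.toFun x (e l x) (e k x)
        - ∑ l, christoffel e i k l x * η.toFun x (e j x) (e l x) := by
  rw [covDeriv_apply η _ (he.smoothAt j) (he.smoothAt k), he.leviCivita_eq_sum,
    he.leviCivita_eq_sum]
  simp only [map_sum, map_smul, sum_apply, smul_apply, smul_eq_mul]

end TwoForm

end General

/-! ### Chain rule, gradient, and symmetries of the curvature -/

section General

variable {E : Type*} [NormedAddCommGroup E] [NormedSpace ℝ E] [FiniteDimensional ℝ E]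
  {H : Type*} [TopologicalSpace H] {I : ModelWithCorners ℝ E H}
  {M : Type*} [TopologicalSpace M] [ChartedSpace H M] [IsManifold I ∞ M]

theorem mvfderiv_comp_real {φ : ℝ → ℝ} {g : M → ℝ} {x : M} (hφ : DifferentiableAt ℝ φ (g x))
    (hg : MDiffAt g x) (v : TangentSpace I x) :
    d% (fun y ↦ φ (g y)) x v = deriv φ (g x) * d% g x v := by
  have h := mfderiv_comp x hφ.mdifferentiableAt hg
  have h1 := congrArg (fun L ↦ L v) h
  rw [mfderiv_eq_fderiv] at h1
  refine h1.trans ?_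
  have h2 (t : ℝ) : fderiv ℝ φ (g x) t = deriv φ (g x) * t := by
    rw [fderiv_eq_smul_deriv, smul_eq_mul, mul_comm]
  exact h2 _

variable [RiemannianBundle (fun x : M ↦ TangentSpace I x)]
  [IsContMDiffRiemannianBundle I ∞ E (fun x : M ↦ TangentSpace I x)]
  {x : M} {ι : Type*} [Fintype ι] {e : ι → Π y : M, TangentSpace I y}

theorem inner_grad (f : M → ℝ) (x : M) (v : TangentSpace I x) :
    inner ℝ (grad f x) v = d% f x v := by
  simp [grad]

theorem IsFrameAt.smoothAt_grad (he : IsFrameAt e x) {f : M → ℝ}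
    (hf : ContMDiffAt I 𝓘(ℝ) ∞ f x) : SmoothAt (grad (I := I) f) x :=
  he.smoothAt_of_inner fun i ↦ by
    have h : (fun y ↦ inner ℝ (e i y) (grad f y)) = fun y ↦ d% f y (e i y) := by
      ext y
      rw [real_inner_comm, inner_grad]
    rw [h]
    exact SmoothAt.mvfderiv_apply hf (he.smoothAt i)

theorem riem_swap_left (u v w z : TangentSpace I x) : riem x u v w z = -riem x v u w z := by
  unfold riem
  rw [curvatureField_swap, inner_neg_left]

theorem IsFrameAt.mvfderiv_christoffel_antisymm (he : ∀ᶠ y in 𝓝 x, IsFrameAt e y) (i j k : ι) :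
    d% (christoffel e i j k) x = -d% (christoffel e i k j) x := by
  rw [← mvfderiv_fun_neg]
  exact mvfderiv_congr (he.mono fun y hy ↦ hy.christoffel_antisymm i j k)

/-- Read off from the structure equation. Antisymmetry of γ is needed on a neighbourhood because
derivatives of γ occur. -/
theorem IsFrameAt.riem_swap_right (he : ∀ᶠ y in 𝓝 x, IsFrameAt e y) (i j k l : ι) :
    riem x (e i x) (e j x) (e k x) (e l x) = -riem x (e i x) (e j x) (e l x) (e k x) := by
  have h := he.self_of_nhds
  rw [h.riem_eq, h.riem_eq, mvfderiv_christoffel_antisymm he j k l,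
    mvfderiv_christoffel_antisymm he i k l]
  have h1 : ∑ m, (christoffel e j k m x * christoffel e i m l x
          - christoffel e i k m x * christoffel e j m l x
          - (christoffel e i j m x - christoffel e j i m x) * christoffel e m k l x)
        = -∑ m, (christoffel e j l m x * christoffel e i m k x
          - christoffel e i l m x * christoffel e j m k x
          - (christoffel e i j m x - christoffel e j i m x) * christoffel e m l k x) := by
    rw [← Finset.sum_neg_distrib]
    refine Finset.sum_congr rfl fun m _ ↦ ?_
    rw [h.christoffel_antisymm i m l, h.christoffel_antisymm j m l, h.christoffel_antisymm m k l,
      h.christoffel_antisymm i m k, h.christoffel_antisymm j m k]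
    ring
  rw [h1]
  simp only [neg_apply]
  ring

end General

/-! ### The harmonic equations in an adapted frame -/

section Adapted

variable {M : Type*} [TopologicalSpace M] [ChartedSpace (EuclideanSpace ℝ (Fin 4)) M]
  [IsManifold (𝓡 4) ∞ M] [RiemannianBundle (fun x : M ↦ TangentSpace (𝓡 4) x)]
  [IsContMDiffRiemannianBundle (𝓡 4) ∞ (EuclideanSpace ℝ (Fin 4))
    (fun x : M ↦ TangentSpace (𝓡 4) x)]
  {η : TwoForm (𝓡 4) M} {U : Set M} {e : Fin 4 → Π x : M, TangentSpace (𝓡 4) x} {a b : M → ℝ}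
  {x : M}

theorem inner_smul_add_smul {V : Type*} [NormedAddCommGroup V] [InnerProductSpace ℝ V]
    {v : Fin 4 → V} (hv : Orthonormal ℝ v) {i j : Fin 4} (hij : i ≠ j) (c d c' d' : ℝ) :
    inner ℝ (c • v i + d • v j) (c' • v i + d' • v j) = c * c' + d * d' := by
  simp only [inner_add_left, inner_add_right, real_inner_smul_left, real_inner_smul_right,
    orthonormal_iff_ite.1 hv, hij, hij.symm, if_true, if_false]
  ring

theorem norm_sq_smul_add_smul {V : Type*} [NormedAddCommGroup V] [InnerProductSpace ℝ V]
    {v : Fin 4 → V} (hv : Orthonormal ℝ v) {i j : Fin 4} (hij : i ≠ j) (c d : ℝ) :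
    ‖c • v i + d • v j‖ ^ 2 = c ^ 2 + d ^ 2 := by
  rw [← real_inner_self_eq_norm_sq, inner_smul_add_smul hv hij]
  ring

theorem compl_zero_one : ({0, 1} : Finset (Fin 4))ᶜ = {2, 3} := by decide

theorem compl_two_three : ({2, 3} : Finset (Fin 4))ᶜ = {0, 1} := by decide

namespace IsAdaptedFrame

theorem isFrameAt (he : IsAdaptedFrame η U e a b) (hx : x ∈ U) : IsFrameAt e x where
  smoothAt i := (he.contMDiffOn i).contMDiffAt (he.isOpen.mem_nhds hx)
  orthonormal := by
    filter_upwards [he.isOpen.mem_nhds hx] with y hy using he.orthonormal y hy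
  card := by simp

theorem eventually_isFrameAt (he : IsAdaptedFrame η U e a b) (hx : x ∈ U) :
    ∀ᶠ y in 𝓝 x, IsFrameAt e y := by
  filter_upwards [he.isOpen.mem_nhds hx] with y hy using he.isFrameAt hy

theorem apply_frame (he : IsAdaptedFrame η U e a b) (hx : x ∈ U) (i j : Fin 4) :
    η.toFun x (e i x) (e j x) =
      a x * ((if 0 = i then 1 else 0) * (if 1 = j then 1 else 0)
        - (if 0 = j then 1 else 0) * (if 1 = i then 1 else 0))
      + b x * ((if 2 = i then 1 else 0) * (if 3 = j then 1 else 0)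
        - (if 2 = j then 1 else 0) * (if 3 = i then 1 else 0)) := by
  rw [he.eq_wedge x hx]
  simp only [orthonormal_iff_ite.1 (he.orthonormal x hx)]

/-- An adapted frame carries no smoothness assumption on a and b; it is recovered from that of the
form and the frame. -/
theorem eventuallyEq_left (he : IsAdaptedFrame η U e a b) (hx : x ∈ U) :
    a =ᶠ[𝓝 x] fun y ↦ η.toFun y (e 0 y) (e 1 y) := by
  filter_upwards [he.isOpen.mem_nhds hx] with y hy
  rw [he.apply_frame hy]
  simp

theorem eventuallyEq_right (he : IsAdaptedFrame η U e a b) (hx : x ∈ U) :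
    b =ᶠ[𝓝 x] fun y ↦ η.toFun y (e 2 y) (e 3 y) := by
  filter_upwards [he.isOpen.mem_nhds hx] with y hy
  rw [he.apply_frame hy]
  simp

theorem contMDiffAt_left (he : IsAdaptedFrame η U e a b) (hx : x ∈ U) :
    ContMDiffAt (𝓡 4) 𝓘(ℝ) ∞ a x :=
  (η.smoothAt ((he.isFrameAt hx).smoothAt 0) ((he.isFrameAt hx).smoothAt 1)).congr_of_eventuallyEq
    (he.eventuallyEq_left hx)

theorem contMDiffAt_right (he : IsAdaptedFrame η U e a b) (hx : x ∈ U) :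
    ContMDiffAt (𝓡 4) 𝓘(ℝ) ∞ b x :=
  (η.smoothAt ((he.isFrameAt hx).smoothAt 2) ((he.isFrameAt hx).smoothAt 3)).congr_of_eventuallyEq
    (he.eventuallyEq_right hx)

theorem mvfderiv_apply_frame (he : IsAdaptedFrame η U e a b) (hx : x ∈ U) (i j : Fin 4)
    (v : TangentSpace (𝓡 4) x) :
    mvfderiv (𝓡 4) (fun y ↦ η.toFun y (e i y) (e j y)) x v =
      mvfderiv (𝓡 4) a x v * ((if 0 = i then 1 else 0) * (if 1 = j then 1 else 0)
        - (if 0 = j then 1 else 0) * (if 1 = i then 1 else 0))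
      + mvfderiv (𝓡 4) b x v * ((if 2 = i then 1 else 0) * (if 3 = j then 1 else 0)
        - (if 2 = j then 1 else 0) * (if 3 = i then 1 else 0)) := by
  have h : (fun y ↦ η.toFun y (e i y) (e j y)) =ᶠ[𝓝 x] fun y ↦
      a y * ((if 0 = i then 1 else 0) * (if 1 = j then 1 else 0)
        - (if 0 = j then 1 else 0) * (if 1 = i then 1 else 0))
      + b y * ((if 2 = i then 1 else 0) * (if 3 = j then 1 else 0)
        - (if 2 = j then 1 else 0) * (if 3 = i then 1 else 0)) := by
    filter_upwards [he.isOpen.mem_nhds hx] with y hy using he.apply_frame hy i j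
  have ha := (he.contMDiffAt_left hx).mdifferentiableAt (by simp)
  have hb := (he.contMDiffAt_right hx).mdifferentiableAt (by simp)
  have key (c d : ℝ) : mvfderiv (𝓡 4) (fun y ↦ a y * c + b y * d) x v
      = mvfderiv (𝓡 4) a x v * c + mvfderiv (𝓡 4) b x v * d := by
    rw [mvfderiv_fun_add (g := fun y ↦ a y * c) (g' := fun y ↦ b y * d)
      (ha.mul mdifferentiableAt_const) (hb.mul mdifferentiableAt_const),
      mvfderiv_fun_mul (g := fun _ ↦ c) ha mdifferentiableAt_const,
      mvfderiv_fun_mul (g := fun _ ↦ d) hb mdifferentiableAt_const, mvfderiv_const, mvfderiv_const]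
    simp only [smul_zero, zero_add, add_apply, smul_apply, smul_eq_mul]
    ring
  rw [mvfderiv_congr h, key]

/-- The harmonic equations in an adapted frame. -/
theorem harmonic_eq (he : IsAdaptedFrame η U e a b) (hη : η.IsHarmonic) (hx : x ∈ U) (k : Fin 4) :
    a x * mvfderiv (𝓡 4) a x (e k x) - b x * mvfderiv (𝓡 4) b x (e k x) = (a x ^ 2 - b x ^ 2) *
      (if k = 0 ∨ k = 1 then christoffel e 2 2 k x + christoffel e 3 3 k x
        else christoffel e 0 0 k x + christoffel e 1 1 k x) := by
  have hf := he.isFrameAt hx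
  obtain ⟨B, hB⟩ := Orthonormal.exists_orthonormalBasis (he.orthonormal x hx)
    (he.isFrameAt hx).card
  have hd (i j l : Fin 4) := hη.1 x (e i x) (e j x) (e l x)
  have hc (l : Fin 4) := hη.2 x (e l x)
  simp only [dForm_eq, codiff_eq η B, hB, hf.covDeriv_eq, he.mvfderiv_apply_frame hx,
    he.apply_frame hx, Fin.sum_univ_four] at hd hc
  have s0 (i j : Fin 4) := hf.christoffel_self i j
  have s1 (i : Fin 4) := hf.christoffel_antisymm i 1 0
  have s2 (i : Fin 4) := hf.christoffel_antisymm i 2 0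
  have s3 (i : Fin 4) := hf.christoffel_antisymm i 3 0
  have s4 (i : Fin 4) := hf.christoffel_antisymm i 2 1
  have s5 (i : Fin 4) := hf.christoffel_antisymm i 3 1
  have s6 (i : Fin 4) := hf.christoffel_antisymm i 3 2
  -- Along e_k, one equation is dη on e_k and the pair spanning the other plane, the other is d^*η
  -- on the partner of e_k in its own plane. The same torsion coefficient occurs in both, multiplied
  -- by a in one and by b in the other, so combining them with weights a and b (up to sign)
  -- eliminates it.
  have hd0 := hd 0 2 3
  have hd1 := hd 1 2 3
  have hd2 := hd 0 1 2
  have hd3 := hd 0 1 3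
  have hc0 := hc 0
  have hc1 := hc 1
  have hc2 := hc 2
  have hc3 := hc 3
  clear hd hc hη
  fin_cases k
  · have h1 := hd0
    have h2 := hc1
    clear hd0 hd1 hd2 hd3 hc0 hc1 hc2 hc3
    simp [s0, s1, s2, s3, s4, s5, s6] at h1 h2 ⊢
    linear_combination -a x * h2 - b x * h1
  · have h1 := hd1
    have h2 := hc0
    clear hd0 hd1 hd2 hd3 hc0 hc1 hc2 hc3
    simp [s0, s1, s2, s3, s4, s5, s6] at h1 h2 ⊢
    linear_combination a x * h2 - b x * h1
  · have h1 := hd2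
    have h2 := hc3
    clear hd0 hd1 hd2 hd3 hc0 hc1 hc2 hc3
    simp [s0, s1, s2, s3, s4, s5, s6] at h1 h2 ⊢
    linear_combination b x * h2 + a x * h1
  · have h1 := hd3
    have h2 := hc2
    clear hd0 hd1 hd2 hd3 hc0 hc1 hc2 hc3
    simp [s0, s1, s2, s3, s4, s5, s6] at h1 h2 ⊢
    linear_combination -b x * h2 + a x * h1

end IsAdaptedFrame

end Adapted

/-! ### Gradient and Laplacian of ln √(a² - b²) -/

section Adapted

variable {M : Type*} [TopologicalSpace M] [ChartedSpace (EuclideanSpace ℝ (Fin 4)) M]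
  [IsManifold (𝓡 4) ∞ M] [RiemannianBundle (fun x : M ↦ TangentSpace (𝓡 4) x)]
  [IsContMDiffRiemannianBundle (𝓡 4) ∞ (EuclideanSpace ℝ (Fin 4))
    (fun x : M ↦ TangentSpace (𝓡 4) x)]
  {η : TwoForm (𝓡 4) M} {U : Set M} {e : Fin 4 → Π x : M, TangentSpace (𝓡 4) x} {a b f : M → ℝ}
  {x : M}

/-- The components of `H_a + H_b`. -/
noncomputable def meanCoeff (e : Fin 4 → Π x : M, TangentSpace (𝓡 4) x) (k : Fin 4) (x : M) : ℝ :=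
  if k = 0 ∨ k = 1 then christoffel e 2 2 k x + christoffel e 3 3 k x
    else christoffel e 0 0 k x + christoffel e 1 1 k x

theorem sum_meanCoeff_smul (x : M) :
    ∑ k, meanCoeff e k x • e k x = meanCurv e {0, 1} x + meanCurv e {2, 3} x := by
  rw [meanCurv, meanCurv, compl_zero_one, compl_two_three,
    Finset.sum_pair (by decide), Finset.sum_pair (by decide), Fin.sum_univ_four]
  simp only [Finset.sum_pair (show (0 : Fin 4) ≠ 1 by decide),
    Finset.sum_pair (show (2 : Fin 4) ≠ 3 by decide)]
  simp only [meanCoeff, christoffel, gam]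
  simp
  abel

namespace IsAdaptedFrame

/-- The function f is prescribed only on U, so derivatives are taken through this germ, where the
square root has become a factor 1/2. -/
theorem eventuallyEq_log (he : IsAdaptedFrame η U e a b) (hx : x ∈ U)
    (hf : ∀ x ∈ U, f x = Real.log (Real.sqrt (a x ^ 2 - b x ^ 2))) :
    f =ᶠ[𝓝 x] fun y ↦ Real.log (a y * a y - b y * b y) / 2 := by
  filter_upwards [he.isOpen.mem_nhds hx] with y hy
  have := he.sq_lt_sq y hy
  rw [hf y hy, Real.log_sqrt (by linarith), sq, sq]

theorem contMDiffAt_log (he : IsAdaptedFrame η U e a b) (hx : x ∈ U)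
    (hf : ∀ x ∈ U, f x = Real.log (Real.sqrt (a x ^ 2 - b x ^ 2))) :
    ContMDiffAt (𝓡 4) 𝓘(ℝ) ∞ f x := by
  refine ContMDiffAt.congr_of_eventuallyEq ?_ (he.eventuallyEq_log hx hf)
  have ha := he.contMDiffAt_left hx
  have hb := he.contMDiffAt_right hx
  have hpos := he.sq_lt_sq x hx
  have hφ : ContDiffAt ℝ ∞ (fun t ↦ Real.log t / 2) (a x * a x - b x * b x) :=
    (Real.contDiffAt_log.2 (by nlinarith)).div_const 2
  exact hφ.contMDiffAt.comp x ((ha.mul ha).sub (hb.mul hb))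

theorem mvfderiv_log (he : IsAdaptedFrame η U e a b) (hx : x ∈ U)
    (hf : ∀ x ∈ U, f x = Real.log (Real.sqrt (a x ^ 2 - b x ^ 2))) (v : TangentSpace (𝓡 4) x) :
    (a x ^ 2 - b x ^ 2) * mvfderiv (𝓡 4) f x v
      = a x * mvfderiv (𝓡 4) a x v - b x * mvfderiv (𝓡 4) b x v := by
  have ha := (he.contMDiffAt_left hx).mdifferentiableAt (by simp)
  have hb := (he.contMDiffAt_right hx).mdifferentiableAt (by simp)
  have hpos : 0 < a x * a x - b x * b x := by nlinarith only [he.sq_lt_sq x hx]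
  have hd := (Real.hasDerivAt_log hpos.ne').div_const 2
  rw [mvfderiv_congr (he.eventuallyEq_log hx hf),
    mvfderiv_comp_real (φ := fun t ↦ Real.log t / 2) (g := fun y ↦ a y * a y - b y * b y)
      hd.differentiableAt ((ha.mul ha).sub (hb.mul hb)), hd.deriv,
    mvfderiv_fun_sub (g := fun y ↦ a y * a y) (g' := fun y ↦ b y * b y) (ha.mul ha) (hb.mul hb),
    mvfderiv_fun_mul ha ha, mvfderiv_fun_mul hb hb]
  simp only [sub_apply, add_apply, smul_apply, smul_eq_mul, ← sq]
  have hne : a x ^ 2 - b x ^ 2 ≠ 0 := (sub_pos.2 (he.sq_lt_sq x hx)).ne'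
  field_simp
  ring

/-- Both sides times a² - b² equal a da - b db on e_k, and a² - b² is positive on U. -/
theorem inner_grad_log (he : IsAdaptedFrame η U e a b) (hη : η.IsHarmonic) (hx : x ∈ U)
    (hf : ∀ x ∈ U, f x = Real.log (Real.sqrt (a x ^ 2 - b x ^ 2))) (k : Fin 4) :
    inner ℝ (grad f x) (e k x) = meanCoeff e k x := by
  have h1 := he.mvfderiv_log hx hf (e k x)
  rw [he.harmonic_eq hη hx] at h1
  rw [inner_grad]
  exact mul_left_cancel₀ (sub_pos.2 (he.sq_lt_sq x hx)).ne' h1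

theorem grad_log (he : IsAdaptedFrame η U e a b) (hη : η.IsHarmonic) (hx : x ∈ U)
    (hf : ∀ x ∈ U, f x = Real.log (Real.sqrt (a x ^ 2 - b x ^ 2))) :
    grad f x = meanCurv e {0, 1} x + meanCurv e {2, 3} x := by
  rw [← sum_meanCoeff_smul, ← Orthonormal.sum_inner_smul (he.orthonormal x hx)
    (he.isFrameAt hx).card (grad f x)]
  refine Finset.sum_congr rfl fun k _ ↦ ?_
  rw [real_inner_comm, he.inner_grad_log hη hx hf]

theorem mvfderiv_meanCoeff (he : IsAdaptedFrame η U e a b) (hx : x ∈ U) (k : Fin 4) :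
    mvfderiv (𝓡 4) (meanCoeff e k) x =
      if k = 0 ∨ k = 1 then mvfderiv (𝓡 4) (christoffel e 2 2 k) x + mvfderiv (𝓡 4) (christoffel e 3 3 k) x
        else mvfderiv (𝓡 4) (christoffel e 0 0 k) x + mvfderiv (𝓡 4) (christoffel e 1 1 k) x := by
  have h (i j k) := ((he.isFrameAt hx).smoothAt_christoffel i j k).mdifferentiableAt (by simp)
  unfold meanCoeff
  split_ifs
  · exact mvfderiv_fun_add (h 2 2 k) (h 3 3 k)
  · exact mvfderiv_fun_add (h 0 0 k) (h 1 1 k)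

/-- The gradient formula holds on the whole open set, so the components of ∇f may be replaced by
mean curvature coefficients before differentiating. -/
theorem neg_laplacian_log (he : IsAdaptedFrame η U e a b) (hη : η.IsHarmonic) (hx : x ∈ U)
    (hf : ∀ x ∈ U, f x = Real.log (Real.sqrt (a x ^ 2 - b x ^ 2))) :
    -laplacian (𝓡 4) f x = ∑ i, (mvfderiv (𝓡 4) (meanCoeff e i) x (e i x)
      - ∑ m, meanCoeff e m x * christoffel e i i m x) := by
  have hF := he.isFrameAt hx
  rw [laplacian, neg_neg, hF.divergence_eq (hF.smoothAt_grad (he.contMDiffAt_log hx hf))]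
  refine Finset.sum_congr rfl fun i _ ↦ ?_
  have h : (fun y ↦ inner ℝ (grad f y) (e i y)) =ᶠ[𝓝 x] meanCoeff e i := by
    filter_upwards [he.isOpen.mem_nhds hx] with y hy using he.inner_grad_log hη hy hf i
  rw [mvfderiv_congr h]
  simp only [he.inner_grad_log hη hx hf]

theorem norm_torsionVec_left (he : IsAdaptedFrame η U e a b) (hx : x ∈ U) :
    ‖torsionVec e 0 1 x‖ ^ 2 = (christoffel e 0 1 2 x - christoffel e 1 0 2 x) ^ 2
      + (christoffel e 0 1 3 x - christoffel e 1 0 3 x) ^ 2 := by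
  rw [torsionVec, compl_zero_one, Finset.sum_pair (by decide),
    norm_sq_smul_add_smul (he.orthonormal x hx) (by decide)]
  rfl

theorem norm_torsionVec_right (he : IsAdaptedFrame η U e a b) (hx : x ∈ U) :
    ‖torsionVec e 2 3 x‖ ^ 2 = (christoffel e 2 3 0 x - christoffel e 3 2 0 x) ^ 2
      + (christoffel e 2 3 1 x - christoffel e 3 2 1 x) ^ 2 := by
  rw [torsionVec, compl_two_three, Finset.sum_pair (by decide),
    norm_sq_smul_add_smul (he.orthonormal x hx) (by decide)]
  rfl

theorem secondFF_left (i j : Fin 4) (x : M) : secondFF e {0, 1} i j x =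
    ((1 / 2) * (christoffel e i j 2 x + christoffel e j i 2 x)) • e 2 x
      + ((1 / 2) * (christoffel e i j 3 x + christoffel e j i 3 x)) • e 3 x := by
  rw [secondFF, compl_zero_one, Finset.sum_pair (by decide)]
  rfl

theorem secondFF_right (i j : Fin 4) (x : M) : secondFF e {2, 3} i j x =
    ((1 / 2) * (christoffel e i j 0 x + christoffel e j i 0 x)) • e 0 x
      + ((1 / 2) * (christoffel e i j 1 x + christoffel e j i 1 x)) • e 1 x := by
  rw [secondFF, compl_two_three, Finset.sum_pair (by decide)]
  rfl

theorem secondFFNormSq_left (he : IsAdaptedFrame η U e a b) (hx : x ∈ U) :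
    secondFFNormSq e {0, 1} x = christoffel e 0 0 2 x ^ 2 + christoffel e 0 0 3 x ^ 2
      + christoffel e 1 1 2 x ^ 2 + christoffel e 1 1 3 x ^ 2
      + (1 / 2) * (christoffel e 0 1 2 x + christoffel e 1 0 2 x) ^ 2
      + (1 / 2) * (christoffel e 0 1 3 x + christoffel e 1 0 3 x) ^ 2 := by
  have h (c d : ℝ) := norm_sq_smul_add_smul (he.orthonormal x hx) (i := 2) (j := 3) (by decide) c d
  simp only [secondFFNormSq, Finset.sum_pair (show (0 : Fin 4) ≠ 1 by decide), secondFF_left, h]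
  ring

theorem secondFFNormSq_right (he : IsAdaptedFrame η U e a b) (hx : x ∈ U) :
    secondFFNormSq e {2, 3} x = christoffel e 2 2 0 x ^ 2 + christoffel e 2 2 1 x ^ 2
      + christoffel e 3 3 0 x ^ 2 + christoffel e 3 3 1 x ^ 2
      + (1 / 2) * (christoffel e 2 3 0 x + christoffel e 3 2 0 x) ^ 2
      + (1 / 2) * (christoffel e 2 3 1 x + christoffel e 3 2 1 x) ^ 2 := by
  have h (c d : ℝ) := norm_sq_smul_add_smul (he.orthonormal x hx) (i := 0) (j := 1) (by decide) c d
  simp only [secondFFNormSq, Finset.sum_pair (show (2 : Fin 4) ≠ 3 by decide), secondFF_right, h]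
  ring

theorem leafCurv_left (he : IsAdaptedFrame η U e a b) (hx : x ∈ U) :
    leafCurv e 0 1 x = riemFrame e 0 1 1 0 x
      + (christoffel e 0 0 2 x * christoffel e 1 1 2 x
        + christoffel e 0 0 3 x * christoffel e 1 1 3 x)
      - (1 / 4) * ((christoffel e 0 1 2 x + christoffel e 1 0 2 x) ^ 2
        + (christoffel e 0 1 3 x + christoffel e 1 0 3 x) ^ 2) := by
  rw [leafCurv, secondFF_left, secondFF_left, secondFF_left,
    norm_sq_smul_add_smul (he.orthonormal x hx) (by decide),
    inner_smul_add_smul (he.orthonormal x hx) (by decide)]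
  ring

theorem leafCurv_right (he : IsAdaptedFrame η U e a b) (hx : x ∈ U) :
    leafCurv e 2 3 x = riemFrame e 2 3 3 2 x
      + (christoffel e 2 2 0 x * christoffel e 3 3 0 x
        + christoffel e 2 2 1 x * christoffel e 3 3 1 x)
      - (1 / 4) * ((christoffel e 2 3 0 x + christoffel e 3 2 0 x) ^ 2
        + (christoffel e 2 3 1 x + christoffel e 3 2 1 x) ^ 2) := by
  rw [leafCurv, secondFF_right, secondFF_right, secondFF_right,
    norm_sq_smul_add_smul (he.orthonormal x hx) (by decide),
    inner_smul_add_smul (he.orthonormal x hx) (by decide)]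
  ring

/-- The Bochner-type formula for `ln √(a² - b²)`. -/
theorem neg_laplacian_log_eq (he : IsAdaptedFrame η U e a b) (hη : η.IsHarmonic) (hx : x ∈ U)
    (hf : ∀ x ∈ U, f x = Real.log (Real.sqrt (a x ^ 2 - b x ^ 2))) :
    -laplacian (𝓡 4) f x =
      riemFrame e 0 2 2 0 x + riemFrame e 1 2 2 1 x
        + riemFrame e 0 3 3 0 x + riemFrame e 1 3 3 1 x
        + secondFFNormSq e {0, 1} x + secondFFNormSq e {2, 3} x
        - (1 / 2) * ‖torsionVec e 0 1 x‖ ^ 2 - (1 / 2) * ‖torsionVec e 2 3 x‖ ^ 2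
        - ∑ k, meanCoeff e k x ^ 2 := by
  have hF := he.isFrameAt hx
  have hE := he.eventually_isFrameAt hx
  rw [he.neg_laplacian_log hη hx hf, he.norm_torsionVec_left hx, he.norm_torsionVec_right hx,
    he.secondFFNormSq_left hx, he.secondFFNormSq_right hx]
  simp only [riemFrame, hF.riem_eq, he.mvfderiv_meanCoeff hx, meanCoeff, Fin.sum_univ_four]
  -- Antisymmetry brings each γ_{ij}^k to the form j < k, and the t-facts do the same for the
  -- derivatives, of which only mixed ones occur. All eight derivatives in the divergence then match
  -- those in the four mixed curvatures, and a polynomial identity in γ remains.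
  have s0 (i j : Fin 4) := hF.christoffel_self i j
  have s1 (i : Fin 4) := hF.christoffel_antisymm i 1 0
  have s2 (i : Fin 4) := hF.christoffel_antisymm i 2 0
  have s3 (i : Fin 4) := hF.christoffel_antisymm i 3 0
  have s4 (i : Fin 4) := hF.christoffel_antisymm i 2 1
  have s5 (i : Fin 4) := hF.christoffel_antisymm i 3 1
  have t2 (i : Fin 4) := IsFrameAt.mvfderiv_christoffel_antisymm hE i 2 0
  have t3 (i : Fin 4) := IsFrameAt.mvfderiv_christoffel_antisymm hE i 3 0
  have t4 (i : Fin 4) := IsFrameAt.mvfderiv_christoffel_antisymm hE i 2 1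
  have t5 (i : Fin 4) := IsFrameAt.mvfderiv_christoffel_antisymm hE i 3 1
  have s6 (i : Fin 4) := hF.christoffel_antisymm i 3 2
  simp [s0, s1, s2, s3, s4, s5, s6, t2, t3, t4, t5]
  ring

theorem riemFrame_swap (he : IsAdaptedFrame η U e a b) (hx : x ∈ U) (i j : Fin 4) :
    riemFrame e i j j i x = riemFrame e j i i j x := by
  rw [riemFrame, riemFrame, riem_swap_left, IsFrameAt.riem_swap_right (he.eventually_isFrameAt hx),
    neg_neg]

theorem riemFrame_self (i : Fin 4) : riemFrame e i i i i x = 0 := by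
  have := riem_swap_left (e i x) (e i x) (e i x) (e i x)
  rw [riemFrame]
  linarith

theorem scalarCurvature_eq (he : IsAdaptedFrame η U e a b) (hx : x ∈ U) :
    scalarCurvature (𝓡 4) x = 2 * (riemFrame e 0 1 1 0 x + riemFrame e 0 2 2 0 x
      + riemFrame e 0 3 3 0 x + riemFrame e 1 2 2 1 x + riemFrame e 1 3 3 1 x
      + riemFrame e 2 3 3 2 x) := by
  obtain ⟨B, hB⟩ := Orthonormal.exists_orthonormalBasis (he.orthonormal x hx)
    (he.isFrameAt hx).card
  have h : scalarCurvature (𝓡 4) x = ∑ i, ∑ j, riemFrame e i j j i x := by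
    rw [IndefBochner.scalarCurvature_eq B, hB]
    rfl
  simp only [h, Fin.sum_univ_four, riemFrame_self, he.riemFrame_swap hx 1 0,
    he.riemFrame_swap hx 2 0, he.riemFrame_swap hx 3 0, he.riemFrame_swap hx 2 1,
    he.riemFrame_swap hx 3 1, he.riemFrame_swap hx 3 2]
  ring

theorem neg_laplacian_log_of_critical (he : IsAdaptedFrame η U e a b) (hη : η.IsHarmonic)
    (hx : x ∈ U) (hf : ∀ x ∈ U, f x = Real.log (Real.sqrt (a x ^ 2 - b x ^ 2)))
    (h0 : mvfderiv (𝓡 4) f x = 0) :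
    -laplacian (𝓡 4) f x =
      riemFrame e 0 2 2 0 x + riemFrame e 1 2 2 1 x
        + riemFrame e 0 3 3 0 x + riemFrame e 1 3 3 1 x
        + secondFFNormSq e {0, 1} x + secondFFNormSq e {2, 3} x
        - (1 / 2) * ‖torsionVec e 0 1 x‖ ^ 2 - (1 / 2) * ‖torsionVec e 2 3 x‖ ^ 2 := by
  have h (k : Fin 4) : meanCoeff e k x = 0 := by
    rw [← he.inner_grad_log hη hx hf, inner_grad, h0, zero_apply]
  rw [he.neg_laplacian_log_eq hη hx hf]
  simp [h]

/-- For each plane |II|² - |H|² = 2|II(e_i, e_j)|² - 2⟨II(e_i, e_i), II(e_j, e_j)⟩, which the Gauss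
equation makes twice the ambient minus twice the leafwise curvature. The mixed curvatures are half
the scalar curvature minus those of the two planes. -/
theorem neg_laplacian_log_eq_leafCurv (he : IsAdaptedFrame η U e a b) (hη : η.IsHarmonic)
    (hx : x ∈ U) (hf : ∀ x ∈ U, f x = Real.log (Real.sqrt (a x ^ 2 - b x ^ 2))) :
    -laplacian (𝓡 4) f x =
      (1 / 2) * scalarCurvature (𝓡 4) x + riemFrame e 0 1 1 0 x + riemFrame e 2 3 3 2 x
        - 2 * leafCurv e 0 1 x - 2 * leafCurv e 2 3 x
        - (1 / 2) * ‖torsionVec e 0 1 x‖ ^ 2 - (1 / 2) * ‖torsionVec e 2 3 x‖ ^ 2 := by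
  rw [he.neg_laplacian_log_eq hη hx hf, he.scalarCurvature_eq hx, he.leafCurv_left hx,
    he.leafCurv_right hx, he.secondFFNormSq_left hx, he.secondFFNormSq_right hx]
  simp only [Fin.sum_univ_four, meanCoeff]
  simp
  ring

end IsAdaptedFrame

end Adapted

/-! ### Brackets of fields related by a smooth map -/

section Related

variable {E : Type*} [NormedAddCommGroup E] [NormedSpace ℝ E] [FiniteDimensional ℝ E]
  {H : Type*} [TopologicalSpace H] {I : ModelWithCorners ℝ E H}
  {N : Type*} [TopologicalSpace N] [ChartedSpace H N] [IsManifold I ∞ N]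
  {E' : Type*} [NormedAddCommGroup E'] [NormedSpace ℝ E'] [FiniteDimensional ℝ E']
  {H' : Type*} [TopologicalSpace H'] {I' : ModelWithCorners ℝ E' H'}
  {M : Type*} [TopologicalSpace M] [ChartedSpace H' M] [IsManifold I' ∞ M]

/-- Tangent vectors are separated by smooth functions. -/
theorem eq_of_forall_mvfderiv_eq [I'.Boundaryless] {x : M} {v w : TangentSpace I' x}
    (h : ∀ g : M → ℝ, ContMDiffAt I' 𝓘(ℝ) ∞ g x → d% g x v = d% g x w) : v = w := by
  have hinj := (isInvertible_mfderiv_extChartAt (I := I') (mem_extChartAt_source x)).injective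
  apply hinj
  have hs : ContMDiffAt I' 𝓘(ℝ, E') ∞ (extChartAt I' x) x := contMDiffAt_extChartAt
  have hd := hs.mdifferentiableAt (by simp)
  -- The separating functions are linear functionals of a chart, whose differential is invertible.
  refine (SeparatingDual.eq_iff_forall_dual_eq (R := ℝ) (V := E')).2 fun L ↦ ?_
  have h1 := h (fun y ↦ L (extChartAt I' x y)) (L.contMDiff.contMDiffAt.comp x hs)
  have hL : MDifferentiableAt 𝓘(ℝ, E') 𝓘(ℝ) L (extChartAt I' x x) :=
    L.contMDiff.contMDiffAt.mdifferentiableAt (n := ∞) (by simp)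
  have key (v : TangentSpace I' x) : d% (fun y ↦ L (extChartAt I' x y)) x v
      = L (mfderiv I' 𝓘(ℝ, E') (extChartAt I' x) x v) := by
    have := congrArg (fun T ↦ T v) (mfderiv_comp x hL hd)
    rw [ContinuousLinearMap.mfderiv_eq] at this
    exact this
  rwa [key, key] at h1

/-- Brackets of related vector fields are related. -/
theorem mfderiv_mlieBracket_of_related [I'.Boundaryless] {ψ : N → M} {q : N}
    {X Y : Π y : N, TangentSpace I y} {X' Y' : Π y : M, TangentSpace I' y}
    (hψ : ContMDiff I I' ∞ ψ) (hX : SmoothAt X q) (hY : SmoothAt Y q)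
    (hX' : SmoothAt X' (ψ q)) (hY' : SmoothAt Y' (ψ q))
    (hXX' : ∀ y, mfderiv I I' ψ y (X y) = X' (ψ y))
    (hYY' : ∀ y, mfderiv I I' ψ y (Y y) = Y' (ψ y)) :
    mfderiv I I' ψ q (mlieBracket I X Y q) = mlieBracket I' X' Y' (ψ q) := by
  have : CompleteSpace E := FiniteDimensional.complete ℝ E
  have : CompleteSpace E' := FiniteDimensional.complete ℝ E'
  refine eq_of_forall_mvfderiv_eq fun g hg ↦ ?_
  have hd (y : N) : MDiffAt ψ y := hψ.contMDiffAt.mdifferentiableAt (by simp)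
  have hgd := (hψ.continuous.tendsto q).eventually
    (eventually_mdifferentiableAt_of_contMDiffAt hg)
  -- A field related to X' acts on g ∘ ψ as X' acts on g. Applied twice, this matches the
  -- commutators of the two pairs of derivations.
  have hcomp {X : Π y : N, TangentSpace I y} {X' : Π y : M, TangentSpace I' y}
      (h : ∀ y, mfderiv I I' ψ y (X y) = X' (ψ y)) :
      (fun y ↦ d% (fun y ↦ g (ψ y)) y (X y)) =ᶠ[𝓝 q] fun y ↦ d% g (ψ y) (X' (ψ y)) := by
    filter_upwards [hgd] with y hy
    rw [← h]
    exact mvfderiv_comp_apply y hy (hd y) _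
  have hcomp' {X Y : Π y : N, TangentSpace I y} {X' Y' : Π y : M, TangentSpace I' y}
      (hX' : SmoothAt X' (ψ q))
      (h : ∀ y, mfderiv I I' ψ y (X y) = X' (ψ y)) (h' : ∀ y, mfderiv I I' ψ y (Y y) = Y' (ψ y)) :
      d% (fun y ↦ d% (fun y ↦ g (ψ y)) y (X y)) q (Y q)
        = d% (fun y ↦ d% g y (X' y)) (ψ q) (Y' (ψ q)) := by
    rw [mvfderiv_congr (hcomp h), ← h']
    exact mvfderiv_comp_apply (g := fun y ↦ d% g y (X' y)) q
      ((SmoothAt.mvfderiv_apply hg hX').mdifferentiableAt (by simp)) (hd q) _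
  rw [mvfderiv_mlieBracket hg hX' hY', ← hcomp' hY' hYY' hXX', ← hcomp' hX' hXX' hYY']
  exact (mvfderiv_comp_apply q (hg.mdifferentiableAt (by simp)) (hd q) _).symm.trans
    (mvfderiv_mlieBracket (f := g ∘ ψ) (hg.comp q hψ.contMDiffAt) hX hY)

end Related

/-! ### Integral surfaces and the Gauss equation -/

section Surface

variable {M : Type*} [TopologicalSpace M] [ChartedSpace (EuclideanSpace ℝ (Fin 4)) M]
  [IsManifold (𝓡 4) ∞ M] [RiemannianBundle (fun x : M ↦ TangentSpace (𝓡 4) x)]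
  [IsContMDiffRiemannianBundle (𝓡 4) ∞ (EuclideanSpace ℝ (Fin 4))
    (fun x : M ↦ TangentSpace (𝓡 4) x)]
  {η : TwoForm (𝓡 4) M} {U : Set M} {e : Fin 4 → Π x : M, TangentSpace (𝓡 4) x} {a b : M → ℝ}
  {N : Type*} [TopologicalSpace N] [ChartedSpace (EuclideanSpace ℝ (Fin 2)) N]
  [IsManifold (𝓡 2) ∞ N] [RiemannianBundle (fun q : N ↦ TangentSpace (𝓡 2) q)]
  [IsContMDiffRiemannianBundle (𝓡 2) ∞ (EuclideanSpace ℝ (Fin 2))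
    (fun q : N ↦ TangentSpace (𝓡 2) q)]
  {ψ : N → M} {i j : Fin 4}

theorem finrank_span_pair_le {V : Type*} [AddCommGroup V] [Module ℝ V] (u v : V) :
    finrank ℝ (Submodule.span ℝ {u, v}) ≤ 2 := by
  classical
  have h := finrank_span_finset_le_card (R := ℝ) ({u, v} : Finset V)
  rw [Set.finrank, Finset.coe_insert, Finset.coe_singleton] at h
  exact h.trans Finset.card_le_two

namespace IsIntegralSurface

theorem mfderiv_injective (hψ : IsIntegralSurface e U i j ψ) (q : N) :
    Function.Injective (mfderiv (𝓡 2) (𝓡 4) ψ q) := by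
  refine (injective_iff_map_eq_zero _).2 fun v hv ↦ ?_
  rw [← inner_self_eq_zero (𝕜 := ℝ), ← hψ.isometric, hv, inner_zero_left]

/-- The range lies in the plane and has dimension 2 by injectivity, while the span of two vectors
has dimension at most 2. -/
theorem range_mfderiv (hψ : IsIntegralSurface e U i j ψ) (q : N) :
    LinearMap.range (mfderiv (𝓡 2) (𝓡 4) ψ q : TangentSpace (𝓡 2) q →ₗ[ℝ] _)
      = Submodule.span ℝ {e i (ψ q), e j (ψ q)} := by
  refine Submodule.eq_of_le_of_finrank_le ?_ ?_
  · rintro _ ⟨v, rfl⟩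
    exact hψ.tangent q v
  · rw [LinearMap.finrank_range_of_inj (hψ.mfderiv_injective q)]
    have h2 : finrank ℝ (TangentSpace (𝓡 2) q) = 2 := finrank_euclideanSpace_fin
    rw [h2]
    exact finrank_span_pair_le _ _

/-- The frame of an integral surface induced by the ambient frame. -/
theorem exists_frame (hψ : IsIntegralSurface e U i j ψ) (he : IsAdaptedFrame η U e a b)
    (hij : i ≠ j) : ∃ X : Fin 2 → Π y : N, TangentSpace (𝓡 2) y,
      (∀ y, IsFrameAt X y) ∧
      ∀ k y, mfderiv (𝓡 2) (𝓡 4) ψ y (X k y) = e (![i, j] k) (ψ y) := by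
  have hex (k : Fin 2) (y : N) : ∃ v, mfderiv (𝓡 2) (𝓡 4) ψ y v = e (![i, j] k) (ψ y) := by
    have h : e (![i, j] k) (ψ y) ∈ Submodule.span ℝ {e i (ψ y), e j (ψ y)} := by
      apply Submodule.subset_span
      fin_cases k <;> simp
    rw [← hψ.range_mfderiv] at h
    exact h
  choose X hX using hex
  refine ⟨X, fun y ↦ ⟨fun k ↦ ?_, ?_, by simp⟩, hX⟩
  · obtain ⟨F, hF⟩ := exists_isFrameAt (𝓡 2) y
    -- X k is chosen pointwise as a preimage. Its smoothness is visible after pairing with a smooth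
    -- frame of N, since ⟨F_l, X_k⟩ = ⟨dψ F_l, e ∘ ψ⟩ by isometry.
    refine hF.smoothAt_of_inner fun l ↦ ?_
    have h : (fun y ↦ inner ℝ (F l y) (X k y))
        = fun y ↦ inner ℝ (mfderiv (𝓡 2) (𝓡 4) ψ y (F l y)) (e (![i, j] k) (ψ y)) := by
      ext y
      rw [← hψ.isometric, hX]
    rw [h]
    have hs := (he.isFrameAt (hψ.mem y)).smoothAt (![i, j] k)
    exact ContMDiffAt.inner_bundle (F := EuclideanSpace ℝ (Fin 4))
      (E := fun x : M ↦ TangentSpace (𝓡 4) x) (b := ψ)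
      (SmoothAt.mfderiv_apply hψ.contMDiff.contMDiffAt (hF.smoothAt l))
      (ContMDiffAt.comp y hs hψ.contMDiff.contMDiffAt)
  · refine Filter.Eventually.of_forall fun y ↦ orthonormal_iff_ite.2 fun k l ↦ ?_
    rw [← hψ.isometric, hX, hX, orthonormal_iff_ite.1 (he.orthonormal _ (hψ.mem y))]
    have : Function.Injective ![i, j] := by
      intro k l
      fin_cases k <;> fin_cases l <;> simp [hij, hij.symm]
    simp [this.eq_iff]

theorem mfderiv_mlieBracket {X : Fin 2 → Π y : N, TangentSpace (𝓡 2) y} (hX : ∀ y, IsFrameAt X y)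
    (hXe : ∀ k y, mfderiv (𝓡 2) (𝓡 4) ψ y (X k y) = e (![i, j] k) (ψ y))
    (hψ : IsIntegralSurface e U i j ψ) (he : IsAdaptedFrame η U e a b)
    (k l : Fin 2) (y : N) : mfderiv (𝓡 2) (𝓡 4) ψ y (mlieBracket (𝓡 2) (X k) (X l) y)
      = mlieBracket (𝓡 4) (e (![i, j] k)) (e (![i, j] l)) (ψ y) :=
  mfderiv_mlieBracket_of_related hψ.contMDiff ((hX y).smoothAt k) ((hX y).smoothAt l)
    ((he.isFrameAt (hψ.mem y)).smoothAt _) ((he.isFrameAt (hψ.mem y)).smoothAt _) (hXe k) (hXe l)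

/-- Brackets of the induced frame are related to the ambient ones and inner products are preserved,
so the Koszul formula yields the same numbers on both sides. -/
theorem christoffel_eq {X : Fin 2 → Π y : N, TangentSpace (𝓡 2) y} (hX : ∀ y, IsFrameAt X y)
    (hXe : ∀ k y, mfderiv (𝓡 2) (𝓡 4) ψ y (X k y) = e (![i, j] k) (ψ y))
    (hψ : IsIntegralSurface e U i j ψ) (he : IsAdaptedFrame η U e a b)
    (k l m : Fin 2) (y : N) :
    christoffel X k l m y = christoffel e (![i, j] k) (![i, j] l) (![i, j] m) (ψ y) := by
  have h (k l m : Fin 2) : inner ℝ (mlieBracket (𝓡 2) (X k) (X l) y) (X m y)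
      = inner ℝ (mlieBracket (𝓡 4) (e (![i, j] k)) (e (![i, j] l)) (ψ y))
        (e (![i, j] m) (ψ y)) := by
    rw [← hψ.isometric, mfderiv_mlieBracket hX hXe hψ he, hXe]
  rw [(hX y).christoffel_eq_mlieBracket, (he.isFrameAt (hψ.mem y)).christoffel_eq_mlieBracket,
    h, h, h]

/-- The bracket of e_i and e_j at a point of the surface is the image of a tangent vector of N, so
its normal components, the torsion of the distribution, vanish there. -/
theorem christoffel_comm {X : Fin 2 → Π y : N, TangentSpace (𝓡 2) y} (hX : ∀ y, IsFrameAt X y)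
    (hXe : ∀ k y, mfderiv (𝓡 2) (𝓡 4) ψ y (X k y) = e (![i, j] k) (ψ y))
    (hψ : IsIntegralSurface e U i j ψ) (he : IsAdaptedFrame η U e a b)
    (q : N) {m : Fin 4} (hi : m ≠ i) (hj : m ≠ j) :
    christoffel e i j m (ψ q) = christoffel e j i m (ψ q) := by
  have h1 := (he.isFrameAt (hψ.mem q)).inner_mlieBracket i j m
  have h2 := mfderiv_mlieBracket hX hXe hψ he 0 1 q
  have h3 := hψ.tangent q (mlieBracket (𝓡 2) (X 0) (X 1) q)
  rw [h2] at h3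
  obtain ⟨c, d, h4⟩ := Submodule.mem_span_pair.1 h3
  have h5 := orthonormal_iff_ite.1 (he.orthonormal _ (hψ.mem q))
  simp only [Matrix.cons_val_zero, Matrix.cons_val_one] at h4
  rw [← h4, inner_add_left, real_inner_smul_left, real_inner_smul_left, h5, h5,
    if_neg hi.symm, if_neg hj.symm] at h1
  linarith

theorem mvfderiv_christoffel_eq {X : Fin 2 → Π y : N, TangentSpace (𝓡 2) y} (hX : ∀ y, IsFrameAt X y)
    (hXe : ∀ k y, mfderiv (𝓡 2) (𝓡 4) ψ y (X k y) = e (![i, j] k) (ψ y))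
    (hψ : IsIntegralSurface e U i j ψ) (he : IsAdaptedFrame η U e a b)
    (k l m n : Fin 2) (q : N) :
    mvfderiv (𝓡 2) (christoffel X k l m) q (X n q)
      = mvfderiv (𝓡 4) (christoffel e (![i, j] k) (![i, j] l) (![i, j] m)) (ψ q)
        (e (![i, j] n) (ψ q)) := by
  have h : christoffel X k l m = christoffel e (![i, j] k) (![i, j] l) (![i, j] m) ∘ ψ :=
    funext (christoffel_eq hX hXe hψ he k l m)
  rw [h, ← hXe]
  exact mvfderiv_comp_apply q
    (((he.isFrameAt (hψ.mem q)).smoothAt_christoffel _ _ _).mdifferentiableAt (by simp))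
    (hψ.contMDiff.contMDiffAt.mdifferentiableAt (by simp)) _

/-- The intrinsic curvature of an integral surface is given by the Gauss equation. -/
theorem riem_eq_leafCurv (hψ : IsIntegralSurface e U i j ψ) (he : IsAdaptedFrame η U e a b)
    (hij : (i = 0 ∧ j = 1) ∨ (i = 2 ∧ j = 3)) (q : N) (u v : TangentSpace (𝓡 2) q)
    (hu : mfderiv (𝓡 2) (𝓡 4) ψ q u = e i (ψ q)) (hv : mfderiv (𝓡 2) (𝓡 4) ψ q v = e j (ψ q)) :
    riem q u v v u = leafCurv e i j (ψ q) := by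
  have hne : i ≠ j := by rcases hij with ⟨rfl, rfl⟩ | ⟨rfl, rfl⟩ <;> decide
  obtain ⟨X, hX, hXe⟩ := hψ.exists_frame he hne
  obtain rfl : u = X 0 q := hψ.mfderiv_injective q (by rw [hu, hXe]; rfl)
  obtain rfl : v = X 1 q := hψ.mfderiv_injective q (by rw [hv, hXe]; rfl)
  have hF := he.isFrameAt (hψ.mem q)
  have hc {m : Fin 4} := christoffel_comm hX hXe hψ he q (m := m)
  rw [(hX q).riem_eq, mvfderiv_christoffel_eq hX hXe hψ he, mvfderiv_christoffel_eq hX hXe hψ he]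
  simp only [christoffel_eq hX hXe hψ he, Fin.sum_univ_two, Matrix.cons_val_zero,
    Matrix.cons_val_one]
  have s0 (i j : Fin 4) := hF.christoffel_self i j
  have s1 (i : Fin 4) := hF.christoffel_antisymm i 1 0
  have s2 (i : Fin 4) := hF.christoffel_antisymm i 2 0
  have s3 (i : Fin 4) := hF.christoffel_antisymm i 3 0
  have s4 (i : Fin 4) := hF.christoffel_antisymm i 2 1
  have s5 (i : Fin 4) := hF.christoffel_antisymm i 3 1
  have s6 (i : Fin 4) := hF.christoffel_antisymm i 3 2
  -- The two structure equations now differ only by summands with a normal index m. As γ_{ij}^m =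
  -- γ_{ji}^m there, these summands are the second fundamental form terms of `leafCurv`.
  rcases hij with ⟨rfl, rfl⟩ | ⟨rfl, rfl⟩
  · have h2 := hc (m := 2) (by decide) (by decide)
    have h3 := hc (m := 3) (by decide) (by decide)
    rw [he.leafCurv_left (hψ.mem q), riemFrame, hF.riem_eq]
    simp [Fin.sum_univ_four, s0, s1, s2, s3, h2, h3]
    ring
  · have h2 := hc (m := 0) (by decide) (by decide)
    have h3 := hc (m := 1) (by decide) (by decide)
    rw [he.leafCurv_right (hψ.mem q), riemFrame, hF.riem_eq]
    simp [Fin.sum_univ_four, s0, s2, s3, s4, s5, s6] at h2 h3 ⊢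
    simp [h2, h3]
    ring

end IsIntegralSurface

end Surface

/-! ### Norm, Pfaffian and Hodge star of a 2-form in dimension four -/

section Star

variable {V : Type*} [NormedAddCommGroup V] [InnerProductSpace ℝ V] [FiniteDimensional ℝ V]
  {η : V →L[ℝ] V →L[ℝ] ℝ}

theorem apply_swap_of_alternating (hη : ∀ v, η v v = 0) (u v : V) : η u v = -η v u := by
  have h := hη (u + v)
  simp only [map_add, add_apply, hη] at h
  linarith

section Coordinates

variable {b : Fin 4 → V}

theorem apply_eq_sum (η : V →L[ℝ] V →L[ℝ] ℝ) (hb : Orthonormal ℝ b) (hc : finrank ℝ V = 4)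
    (u v : V) : η u v = ∑ k, ∑ l, inner ℝ (b k) u * inner ℝ (b l) v * η (b k) (b l) := by
  have h := Orthonormal.sum_inner_smul hb (by simp [hc])
  conv_lhs => rw [← h u, ← h v]
  simp only [map_sum, map_smul, sum_apply, smul_apply, smul_eq_mul, Finset.mul_sum]
  rw [Finset.sum_comm]
  exact Finset.sum_congr rfl fun _ _ ↦ Finset.sum_congr rfl fun _ _ ↦ by ring

/-- `∑_{k < l} η(b k, b l)²`. -/
noncomputable def normSqForm (η : V →L[ℝ] V →L[ℝ] ℝ) (b : Fin 4 → V) : ℝ :=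
  η (b 0) (b 1) ^ 2 + η (b 0) (b 2) ^ 2 + η (b 0) (b 3) ^ 2 + η (b 1) (b 2) ^ 2
    + η (b 1) (b 3) ^ 2 + η (b 2) (b 3) ^ 2

/-- The Pfaffian of `η` in the frame `b`. -/
noncomputable def pfaffian (η : V →L[ℝ] V →L[ℝ] ℝ) (b : Fin 4 → V) : ℝ :=
  η (b 0) (b 1) * η (b 2) (b 3) - η (b 0) (b 2) * η (b 1) (b 3) + η (b 0) (b 3) * η (b 1) (b 2)

/-- Invariance of the trace, applied to one index at a time. It serves both for |η|² and, with the
volume form as Φ, for the Hodge star. -/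
theorem sum_sq_orthonormalBasis (η : V →L[ℝ] V →L[ℝ] ℝ) {ι ι' : Type*} [Fintype ι] [Fintype ι']
    (b : OrthonormalBasis ι ℝ V) (b' : OrthonormalBasis ι' ℝ V) (Φ : V →L[ℝ] V →L[ℝ] ℝ) :
    ∑ k, ∑ l, η (b k) (b l) * Φ (b k) (b l) = ∑ k, ∑ l, η (b' k) (b' l) * Φ (b' k) (b' l) := by
  have h1 (k : ι) := sum_bilin_orthonormalBasis (fun u v ↦ η (b k) u * Φ (b k) v)
    (by simp [add_mul]) (by simp [mul_assoc]) (by simp [mul_add])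
    (by intros; simp; ring) b b'
  have h2 (k : ι') := sum_bilin_orthonormalBasis (fun u v ↦ η u (b' k) * Φ v (b' k))
    (by simp [add_mul]) (by simp [mul_assoc]) (by simp [mul_add])
    (by intros; simp; ring) b b'
  simp only [h1]
  rw [Finset.sum_comm]
  simp only [h2]
  rw [Finset.sum_comm]

theorem normSqForm_eq_sum (hη : ∀ v, η v v = 0) (b : Fin 4 → V) :
    2 * normSqForm η b = ∑ k, ∑ l, η (b k) (b l) * η (b k) (b l) := by
  simp only [Fin.sum_univ_four, hη, apply_swap_of_alternating hη (b 1) (b 0),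
    apply_swap_of_alternating hη (b 2) (b 0), apply_swap_of_alternating hη (b 3) (b 0),
    apply_swap_of_alternating hη (b 2) (b 1), apply_swap_of_alternating hη (b 3) (b 1),
    apply_swap_of_alternating hη (b 3) (b 2), normSqForm]
  ring

theorem normSqForm_eq (hη : ∀ v, η v v = 0) (hc : finrank ℝ V = 4) {b b' : Fin 4 → V}
    (hb : Orthonormal ℝ b) (hb' : Orthonormal ℝ b') : normSqForm η b = normSqForm η b' := by
  obtain ⟨B, rfl⟩ := Orthonormal.exists_orthonormalBasis hb (by simp [hc])
  obtain ⟨B', rfl⟩ := Orthonormal.exists_orthonormalBasis hb' (by simp [hc])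
  have h := sum_sq_orthonormalBasis η B B' η
  rw [← normSqForm_eq_sum hη, ← normSqForm_eq_sum hη] at h
  linarith

end Coordinates

section Hodge

variable [Fact (finrank ℝ V = 4)] {o : Orientation ℝ V (Fin 4)} {b : OrthonormalBasis (Fin 4) ℝ V}

theorem hodgeStar_eq_sum (o : Orientation ℝ V (Fin 4)) (η : V →L[ℝ] V →L[ℝ] ℝ)
    (b : OrthonormalBasis (Fin 4) ℝ V) (u v : V) :
    hodgeStar o η u v = (1 / 2) * ∑ k, ∑ l, η (b k) (b l) * o.volumeForm ![b k, b l, u, v] := by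
  have hupd (x y z : V) : Function.update ![x, y, u, v] 1 z = ![x, z, u, v] := by
    ext i
    fin_cases i <;> rfl
  let Φ : V →L[ℝ] V →L[ℝ] ℝ := LinearMap.toContinuousLinearMap
    (LinearMap.toContinuousLinearMap.toLinearMap ∘ₗ
      LinearMap.mk₂ ℝ (fun x y ↦ o.volumeForm ![x, y, u, v])
        (fun x x' y ↦ o.volumeForm.map_vecCons_add ![y, u, v] x x')
        (fun c x y ↦ o.volumeForm.map_vecCons_smul ![y, u, v] c x)
        (fun x y y' ↦ by
          simpa only [hupd] using o.volumeForm.map_update_add ![x, y, u, v] 1 y y')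
        (fun c x y ↦ by
          simpa only [hupd] using o.volumeForm.map_update_smul ![x, y, u, v] 1 c y))
  exact congrArg ((1 / 2 : ℝ) * ·)
    (sum_sq_orthonormalBasis η (stdOrthonormalBasis ℝ V) b Φ)

theorem det_fin_four (A : Matrix (Fin 4) (Fin 4) ℝ) : A.det =
      A 0 0 * A 1 1 * A 2 2 * A 3 3 - A 0 0 * A 1 1 * A 2 3 * A 3 2
      - A 0 0 * A 1 2 * A 2 1 * A 3 3 + A 0 0 * A 1 2 * A 2 3 * A 3 1
      + A 0 0 * A 1 3 * A 2 1 * A 3 2 - A 0 0 * A 1 3 * A 2 2 * A 3 1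
      - A 0 1 * A 1 0 * A 2 2 * A 3 3 + A 0 1 * A 1 0 * A 2 3 * A 3 2
      + A 0 1 * A 1 2 * A 2 0 * A 3 3 - A 0 1 * A 1 2 * A 2 3 * A 3 0
      - A 0 1 * A 1 3 * A 2 0 * A 3 2 + A 0 1 * A 1 3 * A 2 2 * A 3 0
      + A 0 2 * A 1 0 * A 2 1 * A 3 3 - A 0 2 * A 1 0 * A 2 3 * A 3 1
      - A 0 2 * A 1 1 * A 2 0 * A 3 3 + A 0 2 * A 1 1 * A 2 3 * A 3 0
      + A 0 2 * A 1 3 * A 2 0 * A 3 1 - A 0 2 * A 1 3 * A 2 1 * A 3 0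
      - A 0 3 * A 1 0 * A 2 1 * A 3 2 + A 0 3 * A 1 0 * A 2 2 * A 3 1
      + A 0 3 * A 1 1 * A 2 0 * A 3 2 - A 0 3 * A 1 1 * A 2 2 * A 3 0
      - A 0 3 * A 1 2 * A 2 0 * A 3 1 + A 0 3 * A 1 2 * A 2 1 * A 3 0 := by
  simp [Matrix.det_succ_row_zero, Fin.sum_univ_succ, Fin.succAbove]
  ring

/-- In a positively oriented basis the star exchanges the components 01 and 23, 03 and 12, and, with
a sign, 02 and 13. -/
theorem hodgeStar_eq (hb : b.toBasis.orientation = o) (hη : ∀ v, η v v = 0) (u v : V) :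
    hodgeStar o η u v =
      η (b 2) (b 3) * (inner ℝ (b 0) u * inner ℝ (b 1) v - inner ℝ (b 1) u * inner ℝ (b 0) v)
      + η (b 0) (b 1) * (inner ℝ (b 2) u * inner ℝ (b 3) v - inner ℝ (b 3) u * inner ℝ (b 2) v)
      - η (b 1) (b 3) * (inner ℝ (b 0) u * inner ℝ (b 2) v - inner ℝ (b 2) u * inner ℝ (b 0) v)
      - η (b 0) (b 2) * (inner ℝ (b 1) u * inner ℝ (b 3) v - inner ℝ (b 3) u * inner ℝ (b 1) v)
      + η (b 1) (b 2) * (inner ℝ (b 0) u * inner ℝ (b 3) v - inner ℝ (b 3) u * inner ℝ (b 0) v)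
      + η (b 0) (b 3) * (inner ℝ (b 1) u * inner ℝ (b 2) v - inner ℝ (b 2) u * inner ℝ (b 1) v) := by
  rw [hodgeStar_eq_sum o η b]
  have hdet (k l : Fin 4) : o.volumeForm ![b k, b l, u, v] =
      (Matrix.of fun i j ↦ inner ℝ (b i) ((![b k, b l, u, v] : Fin 4 → V) j)).det := by
    rw [o.volumeForm_robust b hb, Basis.det_apply]
    congr 1
    ext i j
    simp [Basis.toMatrix_apply, b.repr_apply_apply]
  simp only [hdet, Fin.sum_univ_four, hη, apply_swap_of_alternating hη (b 1) (b 0),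
    apply_swap_of_alternating hη (b 2) (b 0), apply_swap_of_alternating hη (b 3) (b 0),
    apply_swap_of_alternating hη (b 2) (b 1), apply_swap_of_alternating hη (b 3) (b 1),
    apply_swap_of_alternating hη (b 3) (b 2)]
  simp [det_fin_four, b.inner_eq_ite]
  ring

theorem apply_eq_coordinates (hη : ∀ v, η v v = 0) (u v : V) :
    η u v =
      η (b 0) (b 1) * (inner ℝ (b 0) u * inner ℝ (b 1) v - inner ℝ (b 1) u * inner ℝ (b 0) v)
      + η (b 2) (b 3) * (inner ℝ (b 2) u * inner ℝ (b 3) v - inner ℝ (b 3) u * inner ℝ (b 2) v)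
      + η (b 0) (b 2) * (inner ℝ (b 0) u * inner ℝ (b 2) v - inner ℝ (b 2) u * inner ℝ (b 0) v)
      + η (b 1) (b 3) * (inner ℝ (b 1) u * inner ℝ (b 3) v - inner ℝ (b 3) u * inner ℝ (b 1) v)
      + η (b 0) (b 3) * (inner ℝ (b 0) u * inner ℝ (b 3) v - inner ℝ (b 3) u * inner ℝ (b 0) v)
      + η (b 1) (b 2) * (inner ℝ (b 1) u * inner ℝ (b 2) v - inner ℝ (b 2) u * inner ℝ (b 1) v) := by
  rw [apply_eq_sum η b.orthonormal Fact.out]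
  simp only [Fin.sum_univ_four, hη, apply_swap_of_alternating hη (b 1) (b 0),
    apply_swap_of_alternating hη (b 2) (b 0), apply_swap_of_alternating hη (b 3) (b 0),
    apply_swap_of_alternating hη (b 2) (b 1), apply_swap_of_alternating hη (b 3) (b 1),
    apply_swap_of_alternating hη (b 3) (b 2)]
  ring

/-- The difference is (η_{01} - η_{23})² + (η_{02} + η_{13})² + (η_{03} - η_{12})², a sum of squares
whose vanishing is the self-duality equation. -/
theorem two_mul_pfaffian_lt (hb : b.toBasis.orientation = o) (hη : ∀ v, η v v = 0)
    (h : ¬ IsSelfDual o η) : 2 * pfaffian η b < normSqForm η b := by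
  by_contra! hle
  unfold pfaffian normSqForm at hle
  have h1 : η (b 0) (b 1) = η (b 2) (b 3) := by
    refine eq_of_sub_eq_zero (pow_eq_zero_iff (two_ne_zero) |>.1 (le_antisymm ?_ (sq_nonneg _)))
    nlinarith only [hle, sq_nonneg (η (b 0) (b 2) + η (b 1) (b 3)),
      sq_nonneg (η (b 0) (b 3) - η (b 1) (b 2))]
  have h2 : η (b 0) (b 2) = -η (b 1) (b 3) := by
    refine eq_neg_of_add_eq_zero_left
      (pow_eq_zero_iff (two_ne_zero) |>.1 (le_antisymm ?_ (sq_nonneg _)))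
    nlinarith only [hle, sq_nonneg (η (b 0) (b 1) - η (b 2) (b 3)),
      sq_nonneg (η (b 0) (b 3) - η (b 1) (b 2))]
  have h3 : η (b 0) (b 3) = η (b 1) (b 2) := by
    refine eq_of_sub_eq_zero (pow_eq_zero_iff (two_ne_zero) |>.1 (le_antisymm ?_ (sq_nonneg _)))
    nlinarith only [hle, sq_nonneg (η (b 0) (b 2) + η (b 1) (b 3)),
      sq_nonneg (η (b 0) (b 1) - η (b 2) (b 3))]
  refine h fun u v ↦ ?_
  rw [hodgeStar_eq hb hη, apply_eq_coordinates (b := b) hη u v, h1, h2, h3]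
  ring

/-- The same sum of squares with the inner signs reversed; its vanishing is anti-self-duality. -/
theorem neg_two_mul_pfaffian_lt (hb : b.toBasis.orientation = o) (hη : ∀ v, η v v = 0)
    (h : ¬ IsAntiSelfDual o η) : -(2 * pfaffian η b) < normSqForm η b := by
  by_contra! hle
  unfold pfaffian normSqForm at hle
  have h1 : η (b 0) (b 1) = -η (b 2) (b 3) := by
    refine eq_neg_of_add_eq_zero_left
      (pow_eq_zero_iff (two_ne_zero) |>.1 (le_antisymm ?_ (sq_nonneg _)))
    nlinarith only [hle, sq_nonneg (η (b 0) (b 2) - η (b 1) (b 3)),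
      sq_nonneg (η (b 0) (b 3) + η (b 1) (b 2))]
  have h2 : η (b 0) (b 2) = η (b 1) (b 3) := by
    refine eq_of_sub_eq_zero (pow_eq_zero_iff (two_ne_zero) |>.1 (le_antisymm ?_ (sq_nonneg _)))
    nlinarith only [hle, sq_nonneg (η (b 0) (b 1) + η (b 2) (b 3)),
      sq_nonneg (η (b 0) (b 3) + η (b 1) (b 2))]
  have h3 : η (b 0) (b 3) = -η (b 1) (b 2) := by
    refine eq_neg_of_add_eq_zero_left
      (pow_eq_zero_iff (two_ne_zero) |>.1 (le_antisymm ?_ (sq_nonneg _)))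
    nlinarith only [hle, sq_nonneg (η (b 0) (b 2) - η (b 1) (b 3)),
      sq_nonneg (η (b 0) (b 1) + η (b 2) (b 3))]
  refine h fun u v ↦ ?_
  rw [hodgeStar_eq hb hη, apply_eq_coordinates (b := b) hη u v, h1, h2, h3]
  ring

theorem four_mul_pfaffian_sq_lt (hb : b.toBasis.orientation = o) (hη : ∀ v, η v v = 0)
    (h : ¬ IsSelfDual o η) (h' : ¬ IsAntiSelfDual o η) :
    0 < normSqForm η b ^ 2 - 4 * pfaffian η b ^ 2 := by
  have := mul_pos (sub_pos.2 (two_mul_pfaffian_lt hb hη h))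
    (sub_pos.2 (neg_two_mul_pfaffian_lt hb hη h'))
  linarith

end Hodge

/-! ### The skew-symmetric operator of a 2-form -/

/-- The operator `T` with `⟨T u, v⟩ = η(u, v)`. -/
noncomputable def skewMap (η : V →L[ℝ] V →L[ℝ] ℝ) : V →ₗ[ℝ] V where
  toFun u := (InnerProductSpace.toDual ℝ V).symm (η u)
  map_add' := by simp
  map_smul' := by simp

theorem inner_skewMap (u v : V) : inner ℝ (skewMap η u) v = η u v := by
  simp [skewMap]

theorem inner_skewMap_right (hη : ∀ v, η v v = 0) (u v : V) :
    inner ℝ u (skewMap η v) = -inner ℝ (skewMap η u) v := by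
  rw [real_inner_comm, inner_skewMap, inner_skewMap, apply_swap_of_alternating hη]

/-- The Cayley-Hamilton theorem for `T`. -/
theorem skewMap_pow_four (hη : ∀ v, η v v = 0) (hc : finrank ℝ V = 4) {b : Fin 4 → V}
    (hb : Orthonormal ℝ b) (u : V) :
    skewMap η (skewMap η (skewMap η (skewMap η u)))
      + normSqForm η b • skewMap η (skewMap η u) + pfaffian η b ^ 2 • u = 0 := by
  have key (u : V) (l : Fin 4) :
      inner ℝ (b l) (skewMap η u) = ∑ k, inner ℝ (b k) u * η (b k) (b l) := by
    rw [real_inner_comm, inner_skewMap]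
    conv_lhs => rw [← Orthonormal.sum_inner_smul hb (by simp [hc]) u]
    simp
  -- A skew 4 × 4 matrix has characteristic polynomial t⁴ + s t² + Pf². The identity is checked
  -- component by component as a polynomial identity in the six entries.
  refine Orthonormal.ext_inner hb (by simp [hc]) fun l ↦ ?_
  simp only [inner_add_right, inner_smul_right, key, inner_zero_right, Fin.sum_univ_four, hη,
    apply_swap_of_alternating hη (b 1) (b 0),
    apply_swap_of_alternating hη (b 2) (b 0), apply_swap_of_alternating hη (b 3) (b 0),
    apply_swap_of_alternating hη (b 2) (b 1), apply_swap_of_alternating hη (b 3) (b 1),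
    apply_swap_of_alternating hη (b 3) (b 2), normSqForm, pfaffian]
  fin_cases l <;>
  · simp only [Fin.zero_eta, Fin.mk_one, Fin.reduceFinMk, hη, apply_swap_of_alternating hη (b 1) (b 0),
      apply_swap_of_alternating hη (b 2) (b 0), apply_swap_of_alternating hη (b 3) (b 0),
      apply_swap_of_alternating hη (b 2) (b 1), apply_swap_of_alternating hη (b 3) (b 1),
      apply_swap_of_alternating hη (b 3) (b 2)]
    ring

end Star

/-! ### Eigenvectors of T² and invariant planes -/

section Algebra

variable {V : Type*} [NormedAddCommGroup V] [InnerProductSpace ℝ V] [FiniteDimensional ℝ V]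
  {η : V →L[ℝ] V →L[ℝ] ℝ} {b : Fin 4 → V} {α β : ℝ}

/-- Cayley-Hamilton factors as (T² + α)(T² + β) = 0, so T² + β maps every vector into the -α
eigenspace of T². This produces eigenvectors depending smoothly on the form. -/
theorem skewMap_sq_of_root (hη : ∀ v, η v v = 0) (hc : finrank ℝ V = 4) (hb : Orthonormal ℝ b)
    (hs : α + β = normSqForm η b) (hp : α * β = pfaffian η b ^ 2) (u : V) :
    skewMap η (skewMap η (skewMap η (skewMap η u) + β • u))
      = -α • (skewMap η (skewMap η u) + β • u) := by
  have h := skewMap_pow_four hη hc hb u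
  rw [← hs, ← hp] at h
  rw [← sub_eq_zero, ← h]
  simp only [map_add, map_smul]
  module

/-- Otherwise T² = -β on a basis, and taking traces gives 2s = 4β. With s = α + β this forces α = β.
-/
theorem exists_skewMap_sq_add_smul_ne_zero (hη : ∀ v, η v v = 0) (hc : finrank ℝ V = 4)
    (hb : Orthonormal ℝ b) (hs : α + β = normSqForm η b) (h : α ≠ β) :
    ∃ j, skewMap η (skewMap η (b j)) + β • b j ≠ 0 := by
  by_contra! h0
  have h1 (j : Fin 4) : ∑ k, η (b j) (b k) * η (b j) (b k) = β := by
    have h2 := congrArg (fun v ↦ inner ℝ v (b j)) (h0 j)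
    have h3 : inner ℝ (skewMap η (skewMap η (b j))) (b j)
        = -∑ k, η (b j) (b k) * η (b j) (b k) := by
      rw [real_inner_comm, inner_skewMap_right hη,
        ← Orthonormal.sum_inner_mul_inner hb (by simp [hc])]
      simp only [real_inner_comm (skewMap η (b j)), inner_skewMap]
    simp only [inner_add_left, h3, real_inner_smul_left, inner_zero_left,
      orthonormal_iff_ite.1 hb, if_true] at h2
    linarith
  have h2 := normSqForm_eq_sum hη b
  simp only [h1, Finset.sum_const, Finset.card_univ, Fintype.card_fin, nsmul_eq_mul] at h2
  push_cast at h2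
  exact h (by linarith)

variable {u : V} {c : ℝ}

theorem norm_inv_smul_skewMap (hη : ∀ v, η v v = 0) (hc : 0 < c)
    (hu : skewMap η (skewMap η u) = -c ^ 2 • u) (h1 : ‖u‖ = 1) : ‖c⁻¹ • skewMap η u‖ = 1 := by
  have h : ‖skewMap η u‖ ^ 2 = c ^ 2 := by
    rw [← real_inner_self_eq_norm_sq, inner_skewMap_right hη, hu, real_inner_smul_left,
      real_inner_self_eq_norm_sq, h1]
    ring
  rw [norm_smul, norm_inv, Real.norm_of_nonneg hc.le, (sq_eq_sq₀ (norm_nonneg _) hc.le).1 h,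
    inv_mul_cancel₀ hc.ne']

/-- The plane spanned by b 0 and T(b 0) is T-invariant, hence so is its orthogonal complement, and
no mixed components survive. -/
theorem apply_eq_of_skewMap_sq (hη : ∀ v, η v v = 0) (hdim : finrank ℝ V = 4)
    (hb : Orthonormal ℝ b) (hc : 0 < c) (h0 : skewMap η (skewMap η (b 0)) = -c ^ 2 • b 0)
    (h1 : b 1 = c⁻¹ • skewMap η (b 0)) (v w : V) : η v w =
      c * (inner ℝ (b 0) v * inner ℝ (b 1) w - inner ℝ (b 0) w * inner ℝ (b 1) v)
      + η (b 2) (b 3) * (inner ℝ (b 2) v * inner ℝ (b 3) w - inner ℝ (b 2) w * inner ℝ (b 3) v) := by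
  have e0 (w : V) : η (b 0) w = c * inner ℝ (b 1) w := by
    rw [← inner_skewMap, h1, real_inner_smul_left, mul_inv_cancel_left₀ hc.ne']
  have e1 (w : V) : η (b 1) w = -(c * inner ℝ (b 0) w) := by
    rw [← inner_skewMap, h1, map_smul, h0, real_inner_smul_left, real_inner_smul_left]
    field_simp
  rw [apply_eq_sum η hb hdim]
  simp only [Fin.sum_univ_four, hη, apply_swap_of_alternating hη (b 2) (b 0),
    apply_swap_of_alternating hη (b 3) (b 0), apply_swap_of_alternating hη (b 2) (b 1),
    apply_swap_of_alternating hη (b 3) (b 1), apply_swap_of_alternating hη (b 3) (b 2), e0, e1,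
    orthonormal_iff_ite.1 hb]
  simp
  ring

/-- An orthonormal completion has volume 1 or -1; in the second case reversing the last vector
corrects the orientation and leaves u and v alone. -/
theorem exists_orthonormalBasis_volumeForm_eq_one [Fact (finrank ℝ V = 4)]
    (o : Orientation ℝ V (Fin 4)) {u v : V} (hu : ‖u‖ = 1) (hv : ‖v‖ = 1)
    (huv : inner ℝ u v = 0) :
    ∃ b : OrthonormalBasis (Fin 4) ℝ V, b 0 = u ∧ b 1 = v ∧ o.volumeForm b = 1 := by
  have hdim : finrank ℝ V = 4 := Fact.out
  have hvu : inner ℝ v u = 0 := by rw [real_inner_comm, huv]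
  -- The two zeros are placeholders outside the index set {0, 1}, to be replaced by the completion.
  have hs : Orthonormal ℝ (({0, 1} : Set (Fin 4)).domRestrict ![u, v, 0, 0]) := by
    constructor
    · rintro ⟨i, rfl | rfl⟩ <;> simpa
    · rintro ⟨i, rfl | rfl⟩ ⟨k, rfl | rfl⟩ h <;> simp_all
  obtain ⟨b, hb⟩ := hs.exists_orthonormalBasis_extension_of_card_eq (by simp [hdim])
  have hb0 : b 0 = u := hb 0 (by simp)
  have hb1 : b 1 = v := hb 1 (by simp)
  have habs := o.abs_volumeForm_apply_of_orthonormal b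
  rcases eq_or_eq_neg_of_abs_eq habs with h | h
  · exact ⟨b, hb0, hb1, h⟩
  have hw : Orthonormal ℝ (Function.update b 3 (-b 3)) := by
    have hn (i : Fin 4) : Function.update b 3 (-b 3) i = (if i = 3 then (-1 : ℝ) else 1) • b i := by
      rcases eq_or_ne i 3 with rfl | hi <;> simp [*]
    refine orthonormal_iff_ite.2 fun i k ↦ ?_
    rw [hn, hn, real_inner_smul_left, real_inner_smul_right, b.inner_eq_ite]
    split_ifs <;> simp_all
  obtain ⟨b', hb'⟩ := Orthonormal.exists_orthonormalBasis hw (by simp [hdim])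
  refine ⟨b', by simp [hb', hb0], by simp [hb', hb1], ?_⟩
  rw [hb', AlternatingMap.map_update_neg, Function.update_eq_self, h, neg_neg]

end Algebra

/-! ### Smooth dependence of T, the norm and the Pfaffian on the point -/

section General

variable {E : Type*} [NormedAddCommGroup E] [NormedSpace ℝ E] [FiniteDimensional ℝ E]
  {H : Type*} [TopologicalSpace H] {I : ModelWithCorners ℝ E H}
  {M : Type*} [TopologicalSpace M] [ChartedSpace H M] [IsManifold I ∞ M]
  [RiemannianBundle (fun x : M ↦ TangentSpace I x)]
  [IsContMDiffRiemannianBundle I ∞ E (fun x : M ↦ TangentSpace I x)]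
  {η : TwoForm I M} {x : M} {X : Π y : M, TangentSpace I y} {e : Fin 4 → Π y : M, TangentSpace I y}

theorem SmoothAt.skewMap (hX : SmoothAt X x) :
    SmoothAt (fun y ↦ skewMap (η.toFun y) (X y)) x := by
  obtain ⟨F, hF⟩ := exists_isFrameAt I x
  refine hF.smoothAt_of_inner fun i ↦ ?_
  have h : (fun y ↦ Inner.inner ℝ (F i y) (IndefBochner.skewMap (η.toFun y) (X y)))
      = fun y ↦ η.toFun y (X y) (F i y) := by
    ext y
    rw [real_inner_comm, inner_skewMap]
  rw [h]
  exact η.smoothAt hX (hF.smoothAt i)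

theorem contMDiffAt_normSqForm (he : ∀ i, SmoothAt (e i) x) :
    ContMDiffAt I 𝓘(ℝ) ∞ (fun y ↦ normSqForm (η.toFun y) (fun i ↦ e i y)) x := by
  have h (i j) := η.smoothAt (he i) (he j)
  unfold normSqForm
  exact ((((((h 0 1).pow 2).add ((h 0 2).pow 2)).add ((h 0 3).pow 2)).add ((h 1 2).pow 2)).add
    ((h 1 3).pow 2)).add ((h 2 3).pow 2)

theorem contMDiffAt_pfaffian (he : ∀ i, SmoothAt (e i) x) :
    ContMDiffAt I 𝓘(ℝ) ∞ (fun y ↦ pfaffian (η.toFun y) (fun i ↦ e i y)) x := by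
  have h (i j) := η.smoothAt (he i) (he j)
  unfold pfaffian
  exact (((h 0 1).mul (h 2 3)).sub ((h 0 2).mul (h 1 3))).add ((h 0 3).mul (h 1 2))

end General

/-! ### Existence of adapted frames -/

section Existence

variable {M : Type*} [TopologicalSpace M] [ChartedSpace (EuclideanSpace ℝ (Fin 4)) M]
  [IsManifold (𝓡 4) ∞ M] [RiemannianBundle (fun x : M ↦ TangentSpace (𝓡 4) x)]
  [IsContMDiffRiemannianBundle (𝓡 4) ∞ (EuclideanSpace ℝ (Fin 4))
    (fun x : M ↦ TangentSpace (𝓡 4) x)]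

/-- Where `η` is neither self-dual nor anti-self-dual, there is a smooth field of unit eigenvectors
of the square of the skew operator, for its lowest eigenvalue. -/
theorem exists_eigenvector_field (η : TwoForm (𝓡 4) M) (p : M)
    (o : Orientation ℝ (TangentSpace (𝓡 4) p) (Fin 4)) (h : ¬ IsSelfDual o (η.toFun p))
    (h' : ¬ IsAntiSelfDual o (η.toFun p)) :
    ∃ (X : Π x : M, TangentSpace (𝓡 4) x) (c : M → ℝ), ∀ᶠ y in 𝓝 p, SmoothAt X y ∧
      ContMDiffAt (𝓡 4) 𝓘(ℝ) ∞ c y ∧ ‖X y‖ = 1 ∧ 0 < c y ∧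
      skewMap (η.toFun y) (skewMap (η.toFun y) (X y)) = -c y ^ 2 • X y ∧
      ∀ b : Fin 4 → TangentSpace (𝓡 4) y, Orthonormal ℝ b →
        normSqForm (η.toFun y) b < 2 * c y ^ 2 := by
  have hdim (y : M) : finrank ℝ (TangentSpace (𝓡 4) y) = 4 := Fact.out
  let B := o.finOrthonormalBasis (by norm_num) Fact.out
  have hB : B.toBasis.orientation = o := o.finOrthonormalBasis_orientation _ _
  obtain ⟨E, hEs, hEo, hEp⟩ := exists_orthonormal_frame B
  have hEB : (fun i ↦ E i p) = B := funext hEp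
  let s (y : M) : ℝ := normSqForm (η.toFun y) (fun i ↦ E i y)
  let P (y : M) : ℝ := pfaffian (η.toFun y) (fun i ↦ E i y)
  -- The discriminant of t² - s t + P², whose roots are α and β below. Positivity at p, hence
  -- nearby, keeps the roots apart and the square root smooth.
  let D (y : M) : ℝ := s y ^ 2 - 4 * P y ^ 2
  have hs {y : M} (hy : ∀ i, SmoothAt (E i) y) : ContMDiffAt (𝓡 4) 𝓘(ℝ) ∞ s y :=
    contMDiffAt_normSqForm hy
  have hDs {y : M} (hy : ∀ i, SmoothAt (E i) y) : ContMDiffAt (𝓡 4) 𝓘(ℝ) ∞ D y :=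
    ((hs hy).pow 2).sub (contMDiffAt_const.mul ((contMDiffAt_pfaffian hy).pow 2))
  have hDp : 0 < D p := by
    simp only [D, s, P, hEB]
    exact four_mul_pfaffian_sq_lt hB (η.alternating p) h h'
  have hD : ∀ᶠ y in 𝓝 p, 0 < D y :=
    (hDs hEs.self_of_nhds).continuousAt.eventually (lt_mem_nhds hDp)
  have hroot {y : M} (hs : ∀ i, SmoothAt (E i) y) (hy : 0 < D y) :
      ContMDiffAt (𝓡 4) 𝓘(ℝ) ∞ (fun y ↦ Real.sqrt (D y)) y :=
    (Real.contDiffAt_sqrt hy.ne').contMDiffAt.comp y (hDs hs)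
  let α (y : M) : ℝ := (s y + Real.sqrt (D y)) / 2
  let β (y : M) : ℝ := (s y - Real.sqrt (D y)) / 2
  have hsum (y : M) : α y + β y = s y := by simp only [α, β]; ring
  have hprod {y : M} (hy : 0 < D y) : α y * β y = P y ^ 2 := by
    have := Real.sq_sqrt hy.le
    simp only [α, β]
    linear_combination -(1 / 4) * this
  have hs0 (y : M) : 0 ≤ s y := by simp only [s, normSqForm]; positivity
  have hlt {y : M} (hy : 0 < D y) : β y < α y := by
    have := Real.sqrt_pos.2 hy
    simp only [α, β]
    linarith
  have hα {y : M} (hy : 0 < D y) : 0 < α y := by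
    have := Real.sqrt_pos.2 hy
    have := hs0 y
    simp only [α]
    linarith
  -- The index is fixed at p; by continuity the same frame vector has nonzero image under T² + β on
  -- a neighbourhood.
  obtain ⟨j, hj⟩ := exists_skewMap_sq_add_smul_ne_zero (η.alternating p) (hdim p)
    hEo.self_of_nhds (hsum p) (hlt hDp).ne'
  let Z (y : M) : TangentSpace (𝓡 4) y :=
    skewMap (η.toFun y) (skewMap (η.toFun y) (E j y)) + β y • E j y
  have hZs {y : M} (hy : ∀ i, SmoothAt (E i) y) (hD : 0 < D y) : SmoothAt Z y :=
    (hy j).skewMap.skewMap.add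
      (SmoothAt.smul (((hs hy).sub (hroot hy hD)).div_const 2) (hy j))
  have hZ : ∀ᶠ y in 𝓝 p, Z y ≠ 0 := by
    have h1 := hZs hEs.self_of_nhds hDp
    have h2 : ContinuousAt (fun y ↦ inner ℝ (Z y) (Z y)) p := (h1.inner h1).continuousAt
    have h3 : inner ℝ (Z p) (Z p) ≠ 0 := by simpa using hj
    filter_upwards [h2.eventually_ne h3] with y hy h
    simp [h] at hy
  refine ⟨fun y ↦ (‖Z y‖⁻¹ : ℝ) • Z y, fun y ↦ Real.sqrt (α y), ?_⟩
  filter_upwards [hEs, hEo, hD, hZ] with y h1 h2 h3 h4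
  have hsq : Real.sqrt (α y) ^ 2 = α y := Real.sq_sqrt (hα h3).le
  refine ⟨(hZs h1 h3).inv_norm_smul h4, ?_, ?_, Real.sqrt_pos.2 (hα h3), ?_, fun b hb ↦ ?_⟩
  · exact (Real.contDiffAt_sqrt (hα h3).ne').contMDiffAt.comp y
      (((hs h1).add (hroot h1 h3)).div_const 2)
  · simp [norm_smul, h4]
  · have := skewMap_sq_of_root (η.alternating y) (hdim y) h2 (hsum y) (hprod h3) (E j y)
    rw [hsq, map_smul, map_smul, this, smul_comm]
  -- Here s = α + β < 2α. The norm is independent of the orthonormal frame, so the bound also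
  -- applies to the adapted frame built later.
  · rw [hsq, normSqForm_eq (η.alternating y) (hdim y) hb h2]
    have := hsum y
    have := hlt h3
    change s y < _
    linarith

theorem exists_isAdaptedFrame (η : TwoForm (𝓡 4) M) (p : M)
    (o : Orientation ℝ (TangentSpace (𝓡 4) p) (Fin 4)) (h : ¬ IsSelfDual o (η.toFun p))
    (h' : ¬ IsAntiSelfDual o (η.toFun p)) :
    ∃ (U : Set M) (e : Fin 4 → Π x : M, TangentSpace (𝓡 4) x) (a b : M → ℝ),
      p ∈ U ∧ IsAdaptedFrame η U e a b ∧ (∀ x ∈ U, |b x| < a x) ∧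
      o.volumeForm (fun i ↦ e i p) = 1 := by
  have hdim (y : M) : finrank ℝ (TangentSpace (𝓡 4) y) = 4 := Fact.out
  obtain ⟨X, c, hX⟩ := exists_eigenvector_field η p o h h'
  let Y (y : M) : TangentSpace (𝓡 4) y := (c y)⁻¹ • skewMap (η.toFun y) (X y)
  have hY : ∀ᶠ y in 𝓝 p, SmoothAt Y y ∧ ‖Y y‖ = 1 ∧ inner ℝ (X y) (Y y) = 0 := by
    filter_upwards [hX] with y ⟨h1, h2, h3, h4, h5, _⟩
    refine ⟨SmoothAt.smul (f := fun y ↦ (c y)⁻¹) (h2.inv₀ h4.ne') h1.skewMap,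
      norm_inv_smul_skewMap (η.alternating y) h4 h5 h3, ?_⟩
    rw [real_inner_smul_right, real_inner_comm, inner_skewMap, η.alternating, mul_zero]
  obtain ⟨b, hb0, hb1, hvol⟩ := exists_orthonormalBasis_volumeForm_eq_one o
    hX.self_of_nhds.2.2.1 hY.self_of_nhds.2.1 hY.self_of_nhds.2.2
  let F : Fin 4 → Π y : M, TangentSpace (𝓡 4) y :=
    ![X, Y, extend (EuclideanSpace ℝ (Fin 4)) (b 2), extend (EuclideanSpace ℝ (Fin 4)) (b 3)]
  -- X and Y are already orthonormal near p, so Gram-Schmidt keeps them and alters only the last two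
  -- fields; at p it returns the positively oriented basis b.
  obtain ⟨e, hes, heo, hep, heF⟩ := exists_orthonormal_frame_of_smoothAt b (s := F)
    (fun i ↦ by
      fin_cases i
      · exact hX.mono fun y hy ↦ hy.1
      · exact hY.mono fun y hy ↦ hy.1
      · exact eventually_smoothAt_extend (b 2)
      · exact eventually_smoothAt_extend (b 3))
    (fun i ↦ by fin_cases i <;> simp [F, hb0, hb1])
  have hall : ∀ᶠ y in 𝓝 p, (∀ i, SmoothAt (e i) y) ∧ Orthonormal ℝ (fun i ↦ e i y) ∧
      e 0 y = X y ∧ e 1 y = Y y ∧ 0 < c y ∧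
      skewMap (η.toFun y) (skewMap (η.toFun y) (e 0 y)) = -c y ^ 2 • e 0 y ∧
      normSqForm (η.toFun y) (fun i ↦ e i y) < 2 * c y ^ 2 := by
    filter_upwards [hes, heo, hX, hY] with y h1 h2 ⟨_, _, h5, h6, h7, h8⟩ ⟨_, h10, h11⟩
    have h12 : inner ℝ (Y y) (X y) = 0 := by rw [real_inner_comm, h11]
    have e0 : e 0 y = X y := heF 0 y fun j hj k hk ↦ by
      obtain rfl : j = 0 := by simpa using hj
      obtain rfl : k = 0 := by simpa using hk
      simp [F, h5]
    have e1 : e 1 y = Y y := heF 1 y fun j hj k hk ↦ by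
      have hj' : j = 0 ∨ j = 1 := by omega
      have hk' : k = 0 ∨ k = 1 := by omega
      rcases hj' with rfl | rfl <;> rcases hk' with rfl | rfl <;> simp [F, h5, h10, h11, h12]
    exact ⟨h1, h2, e0, e1, h6, by rw [e0, h7], h8 _ h2⟩
  obtain ⟨U, hU, hUo, hpU⟩ := eventually_nhds_iff.1 hall
  have heq (y : M) (hy : y ∈ U) (u v : TangentSpace (𝓡 4) y) := by
    obtain ⟨-, h2, h3, h4, h5, h6, -⟩ := hU y hy
    exact apply_eq_of_skewMap_sq (b := fun i ↦ e i y) (η.alternating y) (hdim y) h2 h5 h6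
      (by rw [h4, h3]) u v
  -- The component η(e 0, e 1) is c, so c² + b² ≤ |η|² < 2c².
  have hsq (y : M) (hy : y ∈ U) : η.toFun y (e 2 y) (e 3 y) ^ 2 < c y ^ 2 := by
    obtain ⟨-, h2, -, -, -, -, h7⟩ := hU y hy
    have h8 := heq y hy (e 0 y) (e 1 y)
    simp only [orthonormal_iff_ite.1 h2] at h8
    simp at h8
    simp only [normSqForm, h8] at h7
    have h9 := sq_nonneg (η.toFun y (e 0 y) (e 2 y))
    have h10 := sq_nonneg (η.toFun y (e 0 y) (e 3 y))
    have h11 := sq_nonneg (η.toFun y (e 1 y) (e 2 y))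
    have h12 := sq_nonneg (η.toFun y (e 1 y) (e 3 y))
    linarith
  refine ⟨U, e, c, fun y ↦ η.toFun y (e 2 y) (e 3 y), hpU,
    ⟨hUo, fun i y hy ↦ ((hU y hy).1 i).contMDiffWithinAt, fun y hy ↦ (hU y hy).2.1, heq, hsq⟩,
    fun y hy ↦ ?_, ?_⟩
  · exact abs_lt_of_sq_lt_sq (hsq y hy) (hU y hy).2.2.2.2.1.le
  · rw [funext hep]
    exact hvol

end Existence

end IndefBochner

theorem mainTheorem3 {M : Type*} [TopologicalSpace M] [ChartedSpace (EuclideanSpace ℝ (Fin 4)) M]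
    [IsManifold (𝓡 4) ∞ M] [RiemannianBundle (fun x : M ↦ TangentSpace (𝓡 4) x)]
    [IsContMDiffRiemannianBundle (𝓡 4) ∞ (EuclideanSpace ℝ (Fin 4))
      (fun x : M ↦ TangentSpace (𝓡 4) x)]
    (h : TwoForm (𝓡 4) M) (hh : h.IsHarmonic) :
    -- adapted oriented frames exist where `h` is neither self-dual nor anti-self-dual
    (∀ (p : M) (o : Orientation ℝ (TangentSpace (𝓡 4) p) (Fin 4)),
      ¬ IsSelfDual o (h.toFun p) → ¬ IsAntiSelfDual o (h.toFun p) →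
      ∃ (U : Set M) (e : Fin 4 → Π x : M, TangentSpace (𝓡 4) x) (a b : M → ℝ),
        p ∈ U ∧ IsAdaptedFrame h U e a b ∧ (∀ x ∈ U, |b x| < a x) ∧
        o.volumeForm (fun i ↦ e i p) = 1) ∧
    -- the formulas in any adapted frame
    ∀ (U : Set M) (e : Fin 4 → Π x : M, TangentSpace (𝓡 4) x) (a b : M → ℝ),
      IsAdaptedFrame h U e a b →
      ∀ f : M → ℝ, (∀ x ∈ U, f x = Real.log (Real.sqrt (a x ^ 2 - b x ^ 2))) →
      ContMDiffOn (𝓡 4) 𝓘(ℝ, ℝ) ∞ f U ∧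
      (∀ x ∈ U, grad f x = meanCurv e {0, 1} x + meanCurv e {2, 3} x) ∧
      (∀ x ∈ U, mvfderiv (𝓡 4) f x = 0 →
        -laplacian (𝓡 4) f x =
          riemFrame e 0 2 2 0 x + riemFrame e 1 2 2 1 x
            + riemFrame e 0 3 3 0 x + riemFrame e 1 3 3 1 x
            + secondFFNormSq e {0, 1} x + secondFFNormSq e {2, 3} x
            - (1 / 2) * ‖torsionVec e 0 1 x‖ ^ 2 - (1 / 2) * ‖torsionVec e 2 3 x‖ ^ 2) ∧
      (∀ x ∈ U,
        -laplacian (𝓡 4) f x =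
          (1 / 2) * scalarCurvature (𝓡 4) x + riemFrame e 0 1 1 0 x + riemFrame e 2 3 3 2 x
            - 2 * leafCurv e 0 1 x - 2 * leafCurv e 2 3 x
            - (1 / 2) * ‖torsionVec e 0 1 x‖ ^ 2 - (1 / 2) * ‖torsionVec e 2 3 x‖ ^ 2) ∧
      -- the leafwise curvatures are the intrinsic curvatures of the integral surfaces
      (∀ (i j : Fin 4), (i = 0 ∧ j = 1) ∨ (i = 2 ∧ j = 3) →
        ∀ (N : Type*) [TopologicalSpace N] [ChartedSpace (EuclideanSpace ℝ (Fin 2)) N]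
          [IsManifold (𝓡 2) ∞ N] [RiemannianBundle (fun q : N ↦ TangentSpace (𝓡 2) q)]
          [IsContMDiffRiemannianBundle (𝓡 2) ∞ (EuclideanSpace ℝ (Fin 2))
            (fun q : N ↦ TangentSpace (𝓡 2) q)]
          (ψ : N → M), IsIntegralSurface e U i j ψ →
          ∀ (q : N) (u v : TangentSpace (𝓡 2) q),
            mfderiv (𝓡 2) (𝓡 4) ψ q u = e i (ψ q) → mfderiv (𝓡 2) (𝓡 4) ψ q v = e j (ψ q) →
            riem q u v v u = leafCurv e i j (ψ q)) := by
  refine ⟨exists_isAdaptedFrame h, fun U e a b he f hf ↦ ⟨?_, ?_, ?_, ?_, ?_⟩⟩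
  · exact fun x hx ↦ (he.contMDiffAt_log hx hf).contMDiffWithinAt
  · exact fun x hx ↦ he.grad_log hh hx hf
  · exact fun x hx h0 ↦ he.neg_laplacian_log_of_critical hh hx hf h0
  · exact fun x hx ↦ he.neg_laplacian_log_eq_leafCurv hh hx hf
  · intro i j hij N _ _ _ _ _ ψ hψ q u v hu hv
    exact hψ.riem_eq_leafCurv he hij q u v hu hv
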